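/- An origami $O$ consists of finitely many copies of the Euclidean unit square together with permutations $\sigma_a,\sigma_b$ of the set of squares that generate a transitive group; the right edge of the square $i$ is glued by a translation to the left edge of $\sigma_a(i)$, and the upper edge of $i$ to the lower edge of $\sigma_b(i)$. Let $X^*$ be the resulting surface with all corners of squares removed. It carries the translation structure pulled back from the torus $\mathbb{R}^2/\mathbb{Z}^2$ along the map that sends each square to the unit square. The Veech group $\Gamma(O)\subseteq \mathrm{GL}_2(\mathbb{R})$ is the group of derivatives $A$ of the orientation preserving affine diffeomorphisms of $X^*$, i.e. those that are of the form $z\mapsto Az+z_0$ in local charts of the translation structure. A non-congruence group is a finite index subgroup of $\mathrm{SL}_2(\mathbb{Z})$ that contains no principal congruence group $\Gamma(N)=\ker(\mathrm{SL}_2(\mathbb{Z})\to \mathrm{SL}_2(\mathbb{Z}/N\mathbb{Z}))$, $N\ge 1$. Consider the following two sequences of origamis $(O_n)_{n\ge 1}$. 1. $n$ cyclic copies of $L(2,3)$: the squares are $1,\dots,4n$, with $$\sigma_a=(1\;3\;4\;5\;7\;8\;\ldots\;4n{-}3\;\,4n{-}1\;\,4n),\qquad \sigma_b=(1\;2)(5\;6)\cdots(4n{-}3\;\,4n{-}2).$$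 2. $n$ cyclic copies of $D$: the squares are $1,\dots,5n$, with $$\sigma_a=(1\;2\;3\;6\;7\;8\;\ldots\;5n{-}4\;\,5n{-}3\;\,5n{-}2),$$ $$\sigma_b=(1\;4\;5)(6\;9\;10)\cdots(5n{-}4\;\,5n{-}1\;\,5n)\,(2\;3)(7\;8)\cdots(5n{-}3\;\,5n{-}2).$$ For each of the two sequences the following holds. - $\Gamma(O_n)\subseteq\Gamma(O_1)$ for all $n\ge 1$, and $\Gamma(O_1)$ is a non-congruence group. - For all $n,m\ge 1$: if $n\mid m$, then $\Gamma(O_m)\subseteq\Gamma(O_n)$. - For all $n,m\ge 1$ with $n\neq m$: $\Gamma(O_n)\neq\Gamma(O_m)$. - For all $n\ge 1$ and $s\in\mathbb{Z}$: $\begin{pmatrix}1&s\\0&1\end{pmatrix}\in\Gamma(O_n)$ if and only if $3n$ divides $s$. -/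

import Mathlib

open Filter Topology
open scoped MatrixGroups

/-! ### Translation structures pulled back from the torus, and Veech groups -/

namespace TorusCover

/-- The projection from the plane to the torus `E = ℝ²/ℤ²`. -/
def planeToTorus (z : Fin 2 → ℝ) : UnitAddTorus (Fin 2) := fun k => (z k : UnitAddCircle)

/-- Let `p : X → E` be a map to the torus. A chart at `x` of the translation structure
pulled back from `E = ℝ²/ℤ²` is a continuous branch of `planeToTorus⁻¹ ∘ p` on a neighbourhood
of `x`. If `p` is a local homeomorphism, these are local homeomorphisms to the plane near `x`,
and two of them differ near `x` by a translation. -/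
def IsChartAt {X : Type*} [TopologicalSpace X] (p : X → UnitAddTorus (Fin 2)) (x : X)
    (φ : X → Fin 2 → ℝ) : Prop :=
  ∃ U ∈ 𝓝 x, ContinuousOn φ U ∧ ∀ y ∈ U, planeToTorus (φ y) = p y

/-- The homeomorphism `f` is affine with derivative `A`: around each point, in charts of the
translation structure, it has the form `z ↦ A z + z₀`. -/
def IsAffineWith {X : Type*} [TopologicalSpace X] (p : X → UnitAddTorus (Fin 2)) (f : X ≃ₜ X)
    (A : GL (Fin 2) ℝ) : Prop :=
  ∀ x : X, ∃ φ ψ : X → Fin 2 → ℝ, IsChartAt p x φ ∧ IsChartAt p (f x) ψ ∧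
    ∃ z₀ : Fin 2 → ℝ, ∀ᶠ y in 𝓝 x, ψ (f y) = A.1.mulVec (φ y) + z₀

section lemmas

variable {X : Type*} [TopologicalSpace X] {p : X → UnitAddTorus (Fin 2)}

theorem exists_isChartAt (hp : Continuous p) (x : X) : ∃ φ, IsChartAt p x φ := by
  have h : ∀ k : Fin 2, ∃ e : OpenPartialHomeomorph ℝ UnitAddCircle,
      p x k ∈ e.target ∧ ∀ t, e t = (t : UnitAddCircle) := by
    intro k
    obtain ⟨t, ht⟩ := QuotientAddGroup.mk_surjective (p x k)
    obtain ⟨e, he, hee⟩ := AddCircle.isLocalHomeomorph_coe (1 : ℝ) t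
    refine ⟨e, ?_, fun t => (congrFun hee t).symm⟩
    have := e.map_source he
    rw [← congrFun hee t] at this
    rwa [← ht]
  choose e he hee using h
  refine ⟨fun y k => (e k).symm (p y k), ⋂ k, {y | p y k ∈ (e k).target}, ?_, ?_, ?_⟩
  · rw [Filter.iInter_mem]
    intro k
    exact ((continuous_apply k).comp hp).continuousAt.preimage_mem_nhds
      ((e k).open_target.mem_nhds (he k))
  · refine continuousOn_pi.2 fun k => ?_
    refine (e k).continuousOn_symm.comp ((continuous_apply k).comp hp).continuousOn ?_
    intro y hy
    exact Set.mem_iInter.1 hy k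
  · intro y hy
    funext k
    have := (e k).right_inv (Set.mem_iInter.1 hy k)
    rwa [hee k] at this

theorem IsChartAt.eventually_eq_add {x : X} {φ ψ : X → Fin 2 → ℝ} (hφ : IsChartAt p x φ)
    (hψ : IsChartAt p x ψ) : ∃ c, ∀ᶠ y in 𝓝 x, ψ y = φ y + c := by
  obtain ⟨U, hU, cU, eU⟩ := hφ
  obtain ⟨V, hV, cV, eV⟩ := hψ
  refine ⟨ψ x - φ x, ?_⟩
  have hc : ContinuousAt (fun y => ψ y - φ y) x :=
    (cV.continuousAt hV).sub (cU.continuousAt hU)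
  have hint : ∀ y ∈ U ∩ V, ∀ k, ∃ n : ℤ, (n : ℝ) = ψ y k - φ y k := by
    intro y hy k
    have h1 := congrFun ((eV y hy.2).trans (eU y hy.1).symm) k
    have h2 : ((ψ y k - φ y k : ℝ) : UnitAddCircle) = 0 := by
      simpa [planeToTorus, sub_eq_zero] using h1
    obtain ⟨n, hn⟩ := (AddCircle.coe_eq_zero_iff (1 : ℝ)).1 h2
    exact ⟨n, by simpa using hn⟩
  filter_upwards [hU, hV, hc (Metric.ball_mem_nhds _ one_pos)] with y hyU hyV hy
  have hk : ∀ k, ψ y k - φ y k = ψ x k - φ x k := by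
    intro k
    obtain ⟨n, hn⟩ := hint y ⟨hyU, hyV⟩ k
    obtain ⟨m, hm⟩ := hint x ⟨mem_of_mem_nhds hU, mem_of_mem_nhds hV⟩ k
    have hd := (dist_pi_lt_iff one_pos).1 (Metric.mem_ball.1 hy) k
    simp only [Pi.sub_apply, Real.dist_eq] at hd
    rw [← hn, ← hm] at hd ⊢
    have hd' : |n - m| < 1 := by exact_mod_cast hd
    rw [sub_eq_zero.1 (Int.abs_lt_one_iff.1 hd')]
  funext k
  have := hk k
  simp only [Pi.add_apply, Pi.sub_apply]
  linarith

theorem isAffineWith_one (hp : Continuous p) : IsAffineWith p (Homeomorph.refl X) 1 := by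
  intro x
  obtain ⟨φ, hφ⟩ := exists_isChartAt hp x
  exact ⟨φ, φ, hφ, hφ, 0, by simp⟩

theorem IsAffineWith.trans {f g : X ≃ₜ X} {A B : GL (Fin 2) ℝ} (hf : IsAffineWith p f A)
    (hg : IsAffineWith p g B) : IsAffineWith p (g.trans f) (A * B) := by
  intro x
  obtain ⟨φ, ψ, hφ, hψ, b, hb⟩ := hg x
  obtain ⟨φ', ψ', hφ', hψ', a, ha⟩ := hf (g x)
  obtain ⟨c, hc⟩ := hψ.eventually_eq_add hφ'
  refine ⟨φ, ψ', hφ, hψ', A.1.mulVec (b + c) + a, ?_⟩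
  filter_upwards [hb, g.continuous.continuousAt.eventually ha,
    g.continuous.continuousAt.eventually hc] with y h1 h2 h3
  simp only [Homeomorph.trans_apply, h2, h3, h1, Units.val_mul, Matrix.mulVec_add,
    ← Matrix.mulVec_mulVec]
  abel

theorem IsAffineWith.symm {f : X ≃ₜ X} {A : GL (Fin 2) ℝ} (hf : IsAffineWith p f A) :
    IsAffineWith p f.symm A⁻¹ := by
  intro x
  obtain ⟨φ, ψ, hφ, hψ, a, ha⟩ := hf (f.symm x)
  rw [f.apply_symm_apply] at hψ
  refine ⟨ψ, φ, hψ, hφ, -(A⁻¹).1.mulVec a, ?_⟩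
  filter_upwards [f.symm.continuous.continuousAt.eventually ha] with y hy
  rw [f.apply_symm_apply] at hy
  have h1 : (A⁻¹).1 * A.1 = 1 := Units.inv_mul A
  rw [hy, Matrix.mulVec_add, Matrix.mulVec_mulVec, h1, Matrix.one_mulVec]
  abel

end lemmas

/-- The Veech group of the translation structure pulled back along `p`: the derivatives of the
orientation preserving affine homeomorphisms (such a map is automatically a diffeomorphism). -/
def veechGroup {X : Type*} [TopologicalSpace X] (p : X → UnitAddTorus (Fin 2))
    (hp : Continuous p) : Subgroup (GL (Fin 2) ℝ) where
  carrier := {A | 0 < A.1.det ∧ ∃ f : X ≃ₜ X, IsAffineWith p f A}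
  mul_mem' := by
    rintro A B ⟨hA, f, hf⟩ ⟨hB, g, hg⟩
    exact ⟨by simpa using mul_pos hA hB, g.trans f, hf.trans hg⟩
  one_mem' := ⟨by simp, Homeomorph.refl X, isAffineWith_one hp⟩
  inv_mem' := by
    rintro A ⟨hA, f, hf⟩
    refine ⟨?_, f.symm, hf.symm⟩
    have h1 : (A⁻¹).1.det * A.1.det = 1 := by
      rw [← Matrix.det_mul, Units.inv_mul, Matrix.det_one]
    exact (pos_iff_pos_of_mul_pos (by rw [h1]; exact one_pos)).2 hA

end TorusCover

/-! ### Origamis -/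

/-- An origami: finitely many unit squares; the right edge of the square `i` is glued to the left
edge of `right i`, and its upper edge to the lower edge of `up i`. The surface is connected, that
is, the two permutations generate a transitive group. -/
structure Origami where
  Square : Type
  finite : Finite Square
  nonempty : Nonempty Square
  right : Equiv.Perm Square
  up : Equiv.Perm Square
  connected : ∀ i j : Square, ∃ g ∈ Subgroup.closure {right, up}, g i = j

namespace Origami

/-- The closed unit square without its four corners. -/
def PuncturedSquare : Type :=
  {z : Fin 2 → ℝ // (∀ k, 0 ≤ z k ∧ z k ≤ 1) ∧ ¬ ∀ k, z k = 0 ∨ z k = 1}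

instance : TopologicalSpace PuncturedSquare := instTopologicalSpaceSubtype

/-- The elementary edge identifications; the squares form a disjoint union. -/
inductive Glue (O : Origami) : (Σ _ : O.Square, PuncturedSquare) →
    (Σ _ : O.Square, PuncturedSquare) → Prop
  | right (i : O.Square) (z w : PuncturedSquare) (hz : z.1 0 = 1) (hw : w.1 0 = 0)
      (h : z.1 1 = w.1 1) : Glue O ⟨i, z⟩ ⟨O.right i, w⟩
  | up (i : O.Square) (z w : PuncturedSquare) (hz : z.1 1 = 1) (hw : w.1 1 = 0)
      (h : z.1 0 = w.1 0) : Glue O ⟨i, z⟩ ⟨O.up i, w⟩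

/-- The punctured surface `X* = X - p⁻¹(∞)`, where `∞` is the image of the corners: the quotient
by the equivalence relation generated by the identifications, with the quotient topology. -/
def Surface (O : Origami) : Type := Quot O.Glue

instance (O : Origami) : TopologicalSpace O.Surface := instTopologicalSpaceQuot

/-- The covering `p` of the torus that maps each square to the unit square. -/
def proj (O : Origami) : O.Surface → UnitAddTorus (Fin 2) :=
  Quot.lift (fun q => TorusCover.planeToTorus q.2.1) (by
    have h10 : ((1 : ℝ) : UnitAddCircle) = ((0 : ℝ) : UnitAddCircle) := by
      simp
    rintro _ _ (⟨i, z, w, hz, hw, h⟩ | ⟨i, z, w, hz, hw, h⟩) <;> funext k <;> fin_cases k <;>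
      simp [TorusCover.planeToTorus, hz, hw, h, h10])

theorem continuous_proj (O : Origami) : Continuous O.proj := by
  refine continuous_quot_lift _ (continuous_sigma fun i => continuous_pi fun k => ?_)
  exact (AddCircle.continuous_mk' (1 : ℝ)).comp
    ((continuous_apply k).comp continuous_subtype_val)

/-- The Veech group `Γ(O) = Γ(X*, μ_I)`. -/
def veechGroup (O : Origami) : Subgroup (GL (Fin 2) ℝ) :=
  TorusCover.veechGroup O.proj O.continuous_proj

/-! ### The two sequences -/

theorem connected_of_reach {S : Type*} (r u : Equiv.Perm S) (b : S)
    (h : ∀ P : S → Prop, P b → (∀ s, P s → P (r s)) → (∀ s, P s → P (u s)) → ∀ s, P s)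
    (i j : S) : ∃ g ∈ Subgroup.closure {r, u}, g i = j := by
  have hr : r ∈ Subgroup.closure {r, u} := Subgroup.subset_closure (by simp)
  have hu : u ∈ Subgroup.closure {r, u} := Subgroup.subset_closure (by simp)
  have key : ∀ s, ∃ g ∈ Subgroup.closure {r, u}, g b = s := by
    refine h _ ⟨1, Subgroup.one_mem _, rfl⟩ ?_ ?_
    · rintro s ⟨g, hg, rfl⟩
      exact ⟨r * g, Subgroup.mul_mem _ hr hg, rfl⟩
    · rintro s ⟨g, hg, rfl⟩
      exact ⟨u * g, Subgroup.mul_mem _ hu hg, rfl⟩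
  obtain ⟨g, hg, rfl⟩ := key i
  obtain ⟨g', hg', rfl⟩ := key j
  exact ⟨g' * g⁻¹, Subgroup.mul_mem _ hg' (Subgroup.inv_mem _ hg), by simp⟩

theorem zmod_cyclic_induction {n : ℕ+} {P : ZMod n → Prop} (h0 : P 0)
    (h : ∀ k, P k → P (k + 1)) (k : ZMod n) : P k := by
  rw [← ZMod.natCast_zmod_val k]
  induction k.val with
  | zero => simpa using h0
  | succ m ih => simpa using h _ ih

/-- In each of `n` copies of `L(2,3)`, the squares `0, 2, 3` form the horizontal row and `1` lies
above `0`. The row of each copy continues cyclically in the row of the next copy: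
`0 → 2 → 3 → 0 of the next copy`. -/
def rightL (n : ℕ+) : Equiv.Perm (ZMod n × Fin 4) where
  toFun
    | (k, 0) => (k, 2)
    | (k, 1) => (k, 1)
    | (k, 2) => (k, 3)
    | (k, 3) => (k + 1, 0)
  invFun
    | (k, 0) => (k - 1, 3)
    | (k, 1) => (k, 1)
    | (k, 2) => (k, 0)
    | (k, 3) => (k, 2)
  left_inv := by rintro ⟨k, j⟩; fin_cases j <;> simp
  right_inv := by rintro ⟨k, j⟩; fin_cases j <;> simp

/-- In each copy of `L(2,3)` the vertical gluing is the transposition of `0` and `1`. -/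
def upL (n : ℕ+) : Equiv.Perm (ZMod n × Fin 4) :=
  Equiv.prodCongr (Equiv.refl _) (Equiv.swap 0 1)

/-- The origami made of `n` cyclically glued copies of `L(2,3)`. -/
def seqL (n : ℕ+) : Origami where
  Square := ZMod n × Fin 4
  finite := inferInstance
  nonempty := inferInstance
  right := rightL n
  up := upL n
  connected := connected_of_reach _ _ (0, 0) fun P h0 hr hu => by
    have h : ∀ k, P (k, 0) := zmod_cyclic_induction h0 fun k hk => hr _ (hr _ (hr _ hk))
    rintro ⟨k, j⟩
    fin_cases j
    · exact h k
    · exact hu _ (h k)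
    · exact hr _ (h k)
    · exact hr _ (hr _ (h k))

/-- In each of `n` copies of `D`, the squares `0, 1, 2` form the horizontal row and `3, 4` lie
above `0`. The row of each copy continues cyclically in the row of the next copy:
`0 → 1 → 2 → 0 of the next copy`. -/
def rightD (n : ℕ+) : Equiv.Perm (ZMod n × Fin 5) where
  toFun
    | (k, 0) => (k, 1)
    | (k, 1) => (k, 2)
    | (k, 2) => (k + 1, 0)
    | (k, 3) => (k, 3)
    | (k, 4) => (k, 4)
  invFun
    | (k, 0) => (k - 1, 2)
    | (k, 1) => (k, 0)
    | (k, 2) => (k, 1)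
    | (k, 3) => (k, 3)
    | (k, 4) => (k, 4)
  left_inv := by rintro ⟨k, j⟩; fin_cases j <;> simp
  right_inv := by rintro ⟨k, j⟩; fin_cases j <;> simp

/-- In each copy of `D` the vertical gluing has the cycles `0 → 3 → 4 → 0` and `1 → 2 → 1`. -/
def upD (n : ℕ+) : Equiv.Perm (ZMod n × Fin 5) :=
  Equiv.prodCongr (Equiv.refl _)
    { toFun := ![3, 2, 1, 4, 0]
      invFun := ![4, 2, 1, 0, 3]
      left_inv := by decide
      right_inv := by decide }

/-- The origami made of `n` cyclically glued copies of `D`. -/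
def seqD (n : ℕ+) : Origami where
  Square := ZMod n × Fin 5
  finite := inferInstance
  nonempty := inferInstance
  right := rightD n
  up := upD n
  connected := connected_of_reach _ _ (0, 0) fun P h0 hr hu => by
    have h : ∀ k, P (k, 0) := zmod_cyclic_induction h0 fun k hk => hr _ (hr _ (hr _ hk))
    rintro ⟨k, j⟩
    fin_cases j
    · exact h k
    · exact hr _ (h k)
    · exact hr _ (hr _ (h k))
    · exact hu _ (h k)
    · exact hu _ (hu _ (h k))

end Origami

/-- A subgroup of `GL₂(ℝ)` is a non-congruence group if it is a finite index subgroup of `SL₂(ℤ)`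
that contains no principal congruence group `Γ(N)`, `N ≥ 1`. -/
def IsNoncongruenceGroup (Γ : Subgroup (GL (Fin 2) ℝ)) : Prop :=
  ∃ G : Subgroup SL(2, ℤ), Γ = G.map (Matrix.SpecialLinearGroup.mapGL ℝ) ∧ G.FiniteIndex ∧
    ¬ CongruenceSubgroup.IsCongruenceSubgroup G

/-! The geometry reduces to permutations. An affine homeomorphism has bounded behaviour near a
removed corner, so it must send corners to corners. Its derivative is therefore an integral matrix,
and the map lifts the corresponding automorphism of the torus (`exists_lifts_of_mem`). Each `A` in
SL₂(ℤ) is induced by an automorphism `φ` of the free group F₂, built from a shear and a quarter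
turn. `A` belongs to the Veech group exactly when the monodromy `F₂ → Sym(squares)` and its
composite with `φ` are conjugate (`mem_veechGroup_iff`).

For the inclusions, the origami with m copies covers the one with n copies. All its translations are
powers of the shift to the next copy. A twisted symmetry normalises this cyclic group, hence also
the subgroup generated by the n-th power, and so descends (`veechGroup_le_of_cover`). For T^s,
squares fixed by the horizontal permutation are rigid markers: they force its (-s)-th power to fix a
square on the row of length 3n. This gives 3n ∣ s, which also separates the groups.

For non-congruence, suppose Γ(N) is contained in the group. Take e idempotent mod N with e ≡ 4 mod
12. The commutator of T^e with Y = S T^(1-e) S⁻¹ is trivial mod N. The conjugate Y T^(-e) Y⁻¹ lies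
in the Veech group, because a suitable word in the two permutations has order dividing e. Hence so
does T^e, which contradicts 3 ∤ e (`isNoncongruenceGroup_veechGroup`). -/

namespace TorusCover

/-! ### Integral matrices acting on the torus; fibres of the unit interval over the circle. -/

/-- The endomorphism of the torus induced by an integral matrix. -/
def torusMap (A : SL(2, ℤ)) (e : UnitAddTorus (Fin 2)) : UnitAddTorus (Fin 2) :=
  fun k => ∑ l, A.1 k l • e l

theorem torusMap_one (e : UnitAddTorus (Fin 2)) : torusMap 1 e = e := by
  funext k
  fin_cases k <;> simp [torusMap]

theorem torusMap_mul (A B : SL(2, ℤ)) (e : UnitAddTorus (Fin 2)) :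
    torusMap (A * B) e = torusMap A (torusMap B e) := by
  funext k
  simp only [torusMap, Matrix.SpecialLinearGroup.coe_mul, Matrix.mul_apply, Fin.sum_univ_two,
    add_smul, mul_smul, smul_add]
  abel

theorem planeToTorus_mulVec (A : SL(2, ℤ)) (z : Fin 2 → ℝ) :
    planeToTorus ((Matrix.SpecialLinearGroup.mapGL ℝ A).1.mulVec z) =
      torusMap A (planeToTorus z) := by
  funext k
  simp [planeToTorus, torusMap, Matrix.mulVec, dotProduct, Fin.sum_univ_two,
    ← zsmul_eq_mul]

theorem planeToTorus_add (z w : Fin 2 → ℝ) :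
    planeToTorus (z + w) = planeToTorus z + planeToTorus w := by
  funext k
  simp [planeToTorus]

theorem continuous_planeToTorus : Continuous planeToTorus :=
  continuous_pi fun k => (AddCircle.continuous_mk' (1 : ℝ)).comp (continuous_apply k)

theorem coe_eq_coe_iff (s t : ℝ) : (s : UnitAddCircle) = t ↔ ∃ n : ℤ, s = t + n := by
  rw [← sub_eq_zero, ← AddCircle.coe_sub, AddCircle.coe_eq_zero_iff]
  simp only [zsmul_eq_mul, mul_one]
  exact exists_congr fun n => ⟨fun h => by linarith, fun h => by linarith⟩

theorem coe_eq_zero_iff' (s : ℝ) : (s : UnitAddCircle) = 0 ↔ ∃ n : ℤ, s = n := by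
  simpa using coe_eq_coe_iff s 0

/-- Two points of the closed unit interval with the same image in the circle are equal or the
two endpoints. -/
theorem eq_or_of_coe_eq {s t : ℝ} (hs : 0 ≤ s ∧ s ≤ 1) (ht : 0 ≤ t ∧ t ≤ 1)
    (h : (s : UnitAddCircle) = t) : s = t ∨ (s = 1 ∧ t = 0) ∨ (s = 0 ∧ t = 1) := by
  obtain ⟨n, hn⟩ := (coe_eq_coe_iff s t).1 h
  have h1 : (n : ℝ) ≤ 1 := by linarith
  have h2 : (-1 : ℝ) ≤ n := by linarith
  have h1' : n ≤ 1 := by exact_mod_cast h1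
  have h2' : -1 ≤ n := by exact_mod_cast h2
  have : n = -1 ∨ n = 0 ∨ n = 1 := by omega
  rcases this with rfl | rfl | rfl
  · right; right; push_cast at hn; constructor <;> linarith
  · left; simpa using hn
  · right; left; push_cast at hn; constructor <;> linarith

theorem coe_eq_zero_iff_of_mem {s : ℝ} (hs : 0 ≤ s ∧ s ≤ 1) :
    (s : UnitAddCircle) = 0 ↔ s = 0 ∨ s = 1 := by
  constructor
  · intro h
    rcases eq_or_of_coe_eq (t := 0) hs ⟨le_rfl, zero_le_one⟩ (by simpa using h) with h | h | h
    · exact Or.inl h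
    · exact Or.inr h.1
    · exact Or.inl h.1
  · rintro (rfl | rfl) <;> simp

end TorusCover

/-! ### The surface as a covering of the punctured torus. -/

namespace Origami

open TorusCover

theorem PuncturedSquare.lt_of_ne {z : PuncturedSquare} {k l : Fin 2} (hkl : l ≠ k)
    (h : z.1 k = 0 ∨ z.1 k = 1) : 0 < z.1 l ∧ z.1 l < 1 := by
  have h2 : ¬ (z.1 l = 0 ∨ z.1 l = 1) := by
    intro h2
    refine z.2.2 fun m => ?_
    rcases eq_or_ne m k with rfl | hm
    · exact h
    · have : m = l := by omega
      rwa [this]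
  push Not at h2
  exact ⟨lt_of_le_of_ne (z.2.1 l).1 h2.1.symm, lt_of_le_of_ne (z.2.1 l).2 h2.2⟩

variable (O : Origami)

/-- The point of the surface with coordinates `z` in the square `i`. -/
def pt (i : O.Square) (z : PuncturedSquare) : O.Surface := Quot.mk _ ⟨i, z⟩

/-- The gluing permutation in the coordinate direction `k`. -/
def side : Fin 2 → Equiv.Perm O.Square := ![O.right, O.up]

variable {O}

theorem pt_eq_pt_side (k : Fin 2) (i : O.Square) {z w : PuncturedSquare} (hz : z.1 k = 1)
    (hw : w.1 k = 0) (h : ∀ l, l ≠ k → z.1 l = w.1 l) : O.pt i z = O.pt (O.side k i) w := by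
  fin_cases k
  · exact Quot.sound (Glue.right i z w hz hw (h 1 (by decide)))
  · exact Quot.sound (Glue.up i z w hz hw (h 0 (by decide)))

theorem exists_pt (x : O.Surface) : ∃ i z, x = O.pt i z := by
  obtain ⟨⟨i, z⟩, rfl⟩ := Quot.exists_rep x
  exact ⟨i, z, rfl⟩

/-- Functions on the surface are functions on the squares that respect the gluing. -/
def surfaceLift {β : Type*} (F : O.Square → PuncturedSquare → β)
    (H : ∀ (k : Fin 2) (i : O.Square) (z w : PuncturedSquare), z.1 k = 1 → w.1 k = 0 →
      (∀ l, l ≠ k → z.1 l = w.1 l) → F i z = F (O.side k i) w) : O.Surface → β :=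
  Quot.lift (fun q => F q.1 q.2) (by
    rintro _ _ (⟨i, z, w, hz, hw, h⟩ | ⟨i, z, w, hz, hw, h⟩)
    · exact H 0 i z w hz hw fun l hl => by
        have : l = 1 := by omega
        rwa [this]
    · exact H 1 i z w hz hw fun l hl => by
        have : l = 0 := by omega
        rwa [this])

@[simp]
theorem surfaceLift_pt {β : Type*} (F : O.Square → PuncturedSquare → β) (H)
    (i : O.Square) (z : PuncturedSquare) : surfaceLift F H (O.pt i z) = F i z := rfl

theorem continuous_pt (i : O.Square) : Continuous (O.pt i) :=
  continuous_quot_mk.comp continuous_sigmaMk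

theorem continuous_surfaceLift {β : Type*} [TopologicalSpace β]
    {F : O.Square → PuncturedSquare → β} {H} (hF : ∀ i, Continuous (F i)) :
    Continuous (surfaceLift F H) :=
  continuous_quot_lift _ (continuous_sigma hF)

theorem isOpen_surface_iff {U : Set O.Surface} : IsOpen U ↔ ∀ i, IsOpen (O.pt i ⁻¹' U) :=
  (isQuotientMap_quot_mk (r := O.Glue)).isOpen_preimage.symm.trans isOpen_sigma_iff

theorem continuous_coord (k : Fin 2) : Continuous fun z : PuncturedSquare => z.1 k :=
  (continuous_apply k).comp continuous_subtype_val

theorem proj_ne_zero (x : O.Surface) : O.proj x ≠ 0 := by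
  obtain ⟨i, z, rfl⟩ := exists_pt x
  intro h
  exact z.2.2 fun k => (coe_eq_zero_iff_of_mem (z.2.1 k)).1 (congrFun h k)

open Classical in
/-- Label of the sheets of the covering over the annulus with core in direction `k`, cut open at
the coordinate `ξ`; points outside of the annulus are not labelled. -/
noncomputable def sheet (k : Fin 2) (ξ : ℝ) (h0 : 0 < ξ) (h1 : ξ < 1) :
    O.Surface → Option O.Square :=
  surfaceLift (fun i z => if ∃ l, l ≠ k ∧ (z.1 l = 0 ∨ z.1 l = 1) then none else
    -- Points before the cut take the label of the preceding square. The label is then continuous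
    -- across the glued edge and jumps only at `ξ`.
    if ξ < z.1 k then some i else some ((O.side k).symm i)) (by
    intro k' i z w hz hw h
    rcases eq_or_ne k' k with rfl | hk
    · have : (∃ l, l ≠ k' ∧ (z.1 l = 0 ∨ z.1 l = 1)) ↔
          ∃ l, l ≠ k' ∧ (w.1 l = 0 ∨ w.1 l = 1) :=
        exists_congr fun l => and_congr_right fun hl => by rw [h l hl]
      simp only [this, hz, hw, h1, not_lt.2 h0.le, if_true, if_false, Equiv.symm_apply_apply]
    · rw [if_pos ⟨k', hk, Or.inr hz⟩, if_pos ⟨k', hk, Or.inl hw⟩])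

/-- Over a neighbourhood of each point of the punctured torus there is a locally constant
labelling of the points of the surface that is injective on the fibres. -/
theorem exists_sheets (e : UnitAddTorus (Fin 2)) (he : e ≠ 0) :
    ∃ V, IsOpen V ∧ e ∈ V ∧ ∃ lab : O.Surface → Option O.Square,
      (∀ x, O.proj x ∈ V → ∀ᶠ y in 𝓝 x, lab y = lab x) ∧
      ∀ x y, O.proj x ∈ V → O.proj x = O.proj y → lab x = lab y → x = y := by
  -- A nonzero coordinate `m` places `e` in the annulus whose core runs in the other direction `k`.
  -- The cut `ξ` only has to avoid `e k`, so one of 1/3 and 2/3 serves.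
  obtain ⟨m, hm⟩ : ∃ m, e m ≠ 0 := by
    by_contra! h
    exact he (funext h)
  obtain ⟨k, hk⟩ : ∃ k : Fin 2, ∀ l, l ≠ k → l = m := ⟨1 - m, by intro l hl; omega⟩
  obtain ⟨ξ, h0, h1, hξ⟩ : ∃ ξ : ℝ, 0 < ξ ∧ ξ < 1 ∧ e k ≠ (ξ : UnitAddCircle) := by
    by_cases h : e k = ((1 / 3 : ℝ) : UnitAddCircle)
    · refine ⟨2 / 3, by norm_num, by norm_num, fun h2 => ?_⟩
      rcases eq_or_of_coe_eq (by norm_num) (by norm_num) (h.symm.trans h2) with h | h | h <;>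
        norm_num at h
    · exact ⟨1 / 3, by norm_num, by norm_num, h⟩
  have hnone : ∀ z : PuncturedSquare, (∀ l, l ≠ k → planeToTorus z.1 l ≠ 0) →
      ¬ ∃ l, l ≠ k ∧ (z.1 l = 0 ∨ z.1 l = 1) := by
    rintro z hz ⟨l, hl, h⟩
    exact hz l hl ((coe_eq_zero_iff_of_mem (z.2.1 l)).2 h)
  let V : Set (UnitAddTorus (Fin 2)) := {e | (∀ l, l ≠ k → e l ≠ 0) ∧ e k ≠ (ξ : UnitAddCircle)}
  have hV : IsOpen V := by
    have : V = (⋂ l, {e | l ≠ k → e l ≠ 0}) ∩ {e | e k ≠ (ξ : UnitAddCircle)} := by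
      ext e; simp [V]
    rw [this]
    refine (isOpen_iInter_of_finite fun l => ?_).inter
      (isOpen_ne_fun (continuous_apply k) continuous_const)
    by_cases hl : l = k
    · simp [hl]
    · simpa [hl] using isOpen_ne_fun (continuous_apply l) continuous_const
  refine ⟨V, hV, ⟨fun l hl => hk l hl ▸ hm, hξ⟩, sheet k ξ h0 h1, ?_, ?_⟩
  · intro x hx
    have hopen : IsOpen {y | O.proj y ∈ V ∧ sheet k ξ h0 h1 y = sheet k ξ h0 h1 x} := by
      refine isOpen_surface_iff.2 fun i => isOpen_iff_mem_nhds.2 ?_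
      rintro z ⟨hz, hzx⟩
      have hc : ContinuousAt (fun z => O.proj (O.pt i z)) z :=
        (O.continuous_proj.comp (continuous_pt i)).continuousAt
      have hne : z.1 k ≠ ξ := fun h => hz.2 (by rw [← h]; rfl)
      have hloc : ∀ᶠ w : PuncturedSquare in 𝓝 z, (ξ < w.1 k ↔ ξ < z.1 k) := by
        rcases lt_or_gt_of_ne hne with h | h
        · filter_upwards [(continuous_coord k).continuousAt.eventually (gt_mem_nhds h)] with w hw
          exact ⟨fun h' => absurd h' (not_lt.2 hw.le), fun h' => absurd h' (not_lt.2 h.le)⟩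
        · filter_upwards [(continuous_coord k).continuousAt.eventually (lt_mem_nhds h)] with w hw
          exact ⟨fun _ => h, fun _ => hw⟩
      filter_upwards [hloc, hc.eventually (hV.mem_nhds hz)] with w hw hwV
      refine ⟨hwV, ?_⟩
      rw [← hzx]
      simp only [sheet, surfaceLift_pt, if_neg (hnone w hwV.1), if_neg (hnone z hz.1), hw]
    filter_upwards [hopen.mem_nhds ⟨hx, rfl⟩] with y hy using hy.2
  · intro x y hx hxy hlab
    have hy : O.proj y ∈ V := hxy ▸ hx
    obtain ⟨i, z, rfl⟩ := exists_pt x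
    obtain ⟨j, w, rfl⟩ := exists_pt y
    simp only [sheet, surfaceLift_pt, if_neg (hnone w hy.1), if_neg (hnone z hx.1)] at hlab
    have hl : ∀ l, l ≠ k → z.1 l = w.1 l := by
      intro l hl
      have hz := mt (coe_eq_zero_iff_of_mem (z.2.1 l)).2 (hx.1 l hl)
      push Not at hz
      rcases eq_or_of_coe_eq (z.2.1 l) (w.2.1 l) (congrFun hxy l) with h | h | h
      · exact h
      · exact absurd h.1 hz.2
      · exact absurd h.1 hz.1
    rcases eq_or_of_coe_eq (z.2.1 k) (w.2.1 k) (congrFun hxy k) with h | ⟨hz, hw⟩ | ⟨hz, hw⟩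
    · have hzw : z = w := Subtype.ext (funext fun l => by
        by_cases hlk : l = k
        · rw [hlk, h]
        · exact hl l hlk)
      subst hzw
      have : i = j := by
        split_ifs at hlab
        · exact Option.some.inj hlab
        · exact (O.side k).symm.injective (Option.some.inj hlab)
      rw [this]
    · rw [hz, hw, if_pos h1, if_neg (not_lt.2 h0.le)] at hlab
      rw [pt_eq_pt_side k i hz hw hl, Option.some.inj hlab, Equiv.apply_symm_apply]
    · rw [hz, hw, if_pos h1, if_neg (not_lt.2 h0.le)] at hlab
      rw [pt_eq_pt_side k j hw hz fun l h => (hl l h).symm, ← Option.some.inj hlab,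
        Equiv.apply_symm_apply]

end Origami

/-! ### Lifts of torus automorphisms; lifts of the identity are isomorphisms of origamis. -/

namespace Origami

open TorusCover

variable {O O' O'' : Origami}

/-- The automorphism of the torus given by `A` lifts to a homeomorphism between the surfaces of
two origamis. -/
def Lifts (A : SL(2, ℤ)) (O O' : Origami) : Prop :=
  ∃ g : O.Surface ≃ₜ O'.Surface, ∀ x, O'.proj (g x) = torusMap A (O.proj x)

theorem Lifts.trans {A B : SL(2, ℤ)} (h : Lifts A O O') (h' : Lifts B O' O'') :
    Lifts (B * A) O O'' := by
  obtain ⟨g, hg⟩ := h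
  obtain ⟨g', hg'⟩ := h'
  exact ⟨g.trans g', fun x => by rw [Homeomorph.trans_apply, hg', hg, torusMap_mul]⟩

theorem Lifts.symm {A : SL(2, ℤ)} (h : Lifts A O O') : Lifts A⁻¹ O' O := by
  obtain ⟨g, hg⟩ := h
  refine ⟨g.symm, fun x => ?_⟩
  conv_rhs => rw [← g.apply_symm_apply x, hg, ← torusMap_mul, inv_mul_cancel, torusMap_one]

/-- Origamis are isomorphic if their pairs of permutations are conjugate. -/
def Iso (O O' : Origami) : Prop :=
  ∃ h : O.Square ≃ O'.Square, ∀ k i, h (O.side k i) = O'.side k (h i)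

theorem Iso.symm (h : Iso O O') : Iso O' O := by
  obtain ⟨h, hh⟩ := h
  refine ⟨h.symm, fun k i => ?_⟩
  rw [Equiv.symm_apply_eq, hh, Equiv.apply_symm_apply]

theorem Iso.lifts (h : Iso O O') : Lifts 1 O O' := by
  have key : ∀ {O O' : Origami} (h : O.Square ≃ O'.Square)
      (hh : ∀ k i, h (O.side k i) = O'.side k (h i)),
      ∃ F : O.Surface → O'.Surface, Continuous F ∧ ∀ i z, F (O.pt i z) = O'.pt (h i) z := by
    intro O O' h hh
    refine ⟨surfaceLift (fun i z => O'.pt (h i) z) ?_, continuous_surfaceLift fun i =>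
      continuous_pt _, fun i z => rfl⟩
    intro k i z w hz hw hl
    rw [hh, pt_eq_pt_side k _ hz hw hl]
  obtain ⟨h, hh⟩ := h
  obtain ⟨F, hF, hF'⟩ := key h hh
  obtain ⟨G, hG, hG'⟩ := key h.symm fun k i => by
    rw [Equiv.symm_apply_eq, hh, Equiv.apply_symm_apply]
  refine ⟨⟨⟨F, G, fun x => ?_, fun x => ?_⟩, hF, hG⟩, fun x => ?_⟩
  · obtain ⟨i, z, rfl⟩ := exists_pt x
    rw [hF', hG', Equiv.symm_apply_apply]
  · obtain ⟨i, z, rfl⟩ := exists_pt x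
    rw [hG', hF', Equiv.apply_symm_apply]
  · obtain ⟨i, z, rfl⟩ := exists_pt x
    change O'.proj (F _) = _
    rw [hF', torusMap_one]
    rfl

/-- Corners are extreme points, so removing them preserves convexity. The resulting connectedness
makes locally constant data on a square constant. -/
theorem convex_puncturedSquare :
    Convex ℝ {z : Fin 2 → ℝ | (∀ k, 0 ≤ z k ∧ z k ≤ 1) ∧ ¬ ∀ k, z k = 0 ∨ z k = 1} := by
  intro z hz w hw a b ha hb hab
  have hmem : ∀ k, 0 ≤ (a • z + b • w) k ∧ (a • z + b • w) k ≤ 1 := by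
    intro k
    have hz1 := hz.1 k
    have hw1 := hw.1 k
    simp only [Pi.add_apply, Pi.smul_apply, smul_eq_mul]
    constructor
    · have := mul_nonneg ha hz1.1
      have := mul_nonneg hb hw1.1
      linarith
    · have := mul_le_mul_of_nonneg_left hz1.2 ha
      have := mul_le_mul_of_nonneg_left hw1.2 hb
      linarith
  refine ⟨hmem, fun h => ?_⟩
  rcases ha.eq_or_lt with rfl | ha'
  · have : b = 1 := by linarith
    simp only [zero_smul, zero_add, this, one_smul] at h
    exact hw.2 h
  · refine hz.2 fun k => ?_
    have hz1 := hz.1 k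
    have hw1 := hw.1 k
    have hk := h k
    simp only [Pi.add_apply, Pi.smul_apply, smul_eq_mul] at hk
    rcases hk with hk | hk
    · left
      have h1 := mul_nonneg ha hz1.1
      have h2 := mul_nonneg hb hw1.1
      have : a * z k = 0 := by linarith
      exact (mul_eq_zero.1 this).resolve_left ha'.ne'
    · right
      have h1 := mul_le_mul_of_nonneg_left hz1.2 ha
      have h2 := mul_le_mul_of_nonneg_left hw1.2 hb
      have : a * z k = a * 1 := by linarith
      exact mul_left_cancel₀ ha'.ne' this

instance : PreconnectedSpace PuncturedSquare :=
  Subtype.preconnectedSpace convex_puncturedSquare.isPreconnected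

/-- The centre of the square. -/
noncomputable def centre : PuncturedSquare :=
  ⟨fun _ => 1 / 2, fun _ => by norm_num, fun h => by have := h 0; norm_num at this⟩

/-- A function that names the square at interior points and is `none` on edges respects the gluing.
It separates points of the quotient without any analysis of the generated equivalence relation. -/
theorem square_eq_of_interior {i j : O.Square} {z w : PuncturedSquare}
    (h : ∀ k, 0 < z.1 k ∧ z.1 k < 1) (hp : O.pt i z = O.pt j w) : i = j := by
  classical
  let F : O.Surface → Option O.Square :=
    surfaceLift (fun i z => if ∀ k, 0 < z.1 k ∧ z.1 k < 1 then some i else none) (by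
      intro k i z w hz hw hl
      rw [if_neg fun h => by have := h k; rw [hz] at this; exact lt_irrefl _ this.2,
        if_neg fun h => by have := h k; rw [hw] at this; exact lt_irrefl _ this.1])
  have := congrArg F hp
  simp only [F, surfaceLift_pt, if_pos h] at this
  split_ifs at this
  exact Option.some.inj this

theorem exists_pt_centre {x : O.Surface} (h : O.proj x = planeToTorus centre.1) :
    ∃ i, x = O.pt i centre := by
  obtain ⟨i, z, rfl⟩ := exists_pt x
  refine ⟨i, congrArg _ (Subtype.ext (funext fun k => ?_))⟩
  rcases eq_or_of_coe_eq (z.2.1 k) (centre.2.1 k) (congrFun h k) with h | h | h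
  · exact h
  · simp [centre] at h
  · norm_num [centre] at h

/-- A continuous map over the torus that sends the centre of a square to the centre of a square
sends the whole square there. -/
theorem map_pt_of_centre {g : O.Surface → O'.Surface} (hg : Continuous g)
    (hp : ∀ x, O'.proj (g x) = O.proj x) {i : O.Square} {j : O'.Square}
    (h : g (O.pt i centre) = O'.pt j centre) (z : PuncturedSquare) :
    g (O.pt i z) = O'.pt j z := by
  -- Uniqueness of lifts: both points lie over the same point of the torus, so they agree exactly
  -- when their locally constant sheet labels agree.
  have hloc : IsLocallyConstant fun z => (g (O.pt i z) = O'.pt j z) := by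
    refine (IsLocallyConstant.iff_eventually_eq _).2 fun z => ?_
    obtain ⟨V, hV, hzV, lab, hlab, hinj⟩ :=
      exists_sheets (O := O') (O'.proj (O'.pt j z)) (proj_ne_zero _)
    have h1 : ContinuousAt (fun z => g (O.pt i z)) z :=
      (hg.comp (continuous_pt i)).continuousAt
    have h2 : ContinuousAt (O'.pt j) z := (continuous_pt j).continuousAt
    have hpz : ∀ z, O'.proj (g (O.pt i z)) = O'.proj (O'.pt j z) := fun z => by
      rw [hp]; rfl
    filter_upwards [h1.eventually (hlab _ (by rw [hpz]; exact hzV)), h2.eventually (hlab _ hzV),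
      (O'.continuous_proj.continuousAt.comp h2).eventually (hV.mem_nhds hzV)] with w hw1 hw2 hw3
    refine propext ⟨fun hw => ?_, fun hz => ?_⟩
    · refine hinj _ _ (by rw [hpz]; exact hzV) (hpz z) ?_
      rw [← hw1, ← hw2, hw]
    · refine hinj _ _ (by rw [hpz]; exact hw3) (hpz w) ?_
      rw [hw1, hw2, hz]
  have := hloc.apply_eq_of_preconnectedSpace centre z
  exact this ▸ h

/-- An edge transverse to direction `k` can be labelled by the square that follows it; this label
respects the gluing, with `none` elsewhere. -/
theorem pt_side_eq (k : Fin 2) {i j : O.Square} {z w : PuncturedSquare} (hz : z.1 k = 1)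
    (hw : w.1 k = 0) (h : O.pt i z = O.pt j w) : j = O.side k i := by
  classical
  let F : O.Surface → Option O.Square :=
    surfaceLift (fun i z => if z.1 k = 1 then some (O.side k i) else
      if z.1 k = 0 then some i else none) (by
      intro k' i z' w' hz' hw' hl
      rcases eq_or_ne k' k with rfl | hk
      · rw [if_pos hz', if_neg (by rw [hw']; exact zero_ne_one), if_pos hw']
      · have h1 := PuncturedSquare.lt_of_ne hk.symm (Or.inr hz')
        have h2 := PuncturedSquare.lt_of_ne hk.symm (Or.inl hw')
        rw [if_neg h1.2.ne, if_neg h1.1.ne', if_neg h2.2.ne, if_neg h2.1.ne'])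
  have := congrArg F h
  simp only [F, surfaceLift_pt, hz, hw] at this
  simpa [eq_comm] using this

/-- The lift permutes the centres of squares and carries whole squares along. An edge shared by two
squares goes to an edge shared by their images, so the gluing is respected. -/
theorem Lifts.iso (h : Lifts 1 O O') : Iso O O' := by
  obtain ⟨g, hg⟩ := h
  simp only [torusMap_one] at hg
  have hg' : ∀ x, O.proj (g.symm x) = O'.proj x := fun x => by
    rw [← hg, g.apply_symm_apply]
  choose h hh using fun i => exists_pt_centre (hg (O.pt i centre))
  choose h' hh' using fun i => exists_pt_centre (hg' (O'.pt i centre))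
  have hc : ∀ k, 0 < centre.1 k ∧ centre.1 k < 1 := fun k => by norm_num [centre]
  refine ⟨⟨h, h', fun i => ?_, fun i => ?_⟩, fun k i => ?_⟩
  · refine (square_eq_of_interior (w := centre) hc ?_).symm
    rw [← hh', ← hh, g.symm_apply_apply]
  · refine (square_eq_of_interior (w := centre) hc ?_).symm
    rw [← hh, ← hh', g.apply_symm_apply]
  -- The points `z 0` and `z 1` are the midpoints of the two edges transverse to `k`.
  · let z : ℝ → Fin 2 → ℝ := fun t l => if l = k then t else 1 / 2
    have hz : ∀ t, 0 ≤ t → t ≤ 1 → (∀ l, 0 ≤ z t l ∧ z t l ≤ 1) ∧ ¬ ∀ l, z t l = 0 ∨ z t l = 1 := by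
      intro t h0 h1
      refine ⟨fun l => ?_, fun h => ?_⟩
      · by_cases hl : l = k
        · simp [z, hl, h0, h1]
        · norm_num [z, hl]
      · have hk : (1 - k : Fin 2) ≠ k := by omega
        have := h (1 - k)
        norm_num [z, hk] at this
    let a : PuncturedSquare := ⟨z 1, hz 1 zero_le_one le_rfl⟩
    let b : PuncturedSquare := ⟨z 0, hz 0 le_rfl zero_le_one⟩
    have ha : a.1 k = 1 := by simp [a, z]
    have hb : b.1 k = 0 := by simp [b, z]
    refine pt_side_eq k ha hb ?_
    change O'.pt (h i) a = O'.pt (h (O.side k i)) b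
    rw [← map_pt_of_centre g.continuous hg (hh i) a,
      ← map_pt_of_centre g.continuous hg (hh _) b,
      pt_eq_pt_side k i ha hb fun l hl => by simp [a, b, z, hl]]

end Origami

/-! ### Geometric lifts of the two generators of SL₂(ℤ). -/

namespace Origami

open TorusCover

variable {O O' : Origami}

/-- `(a, b)` is a point of the closed unit square, but not a corner. -/
def InSquare (a b : ℝ) : Prop :=
  (0 ≤ a ∧ a ≤ 1) ∧ (0 ≤ b ∧ b ≤ 1) ∧ ¬ ((a = 0 ∨ a = 1) ∧ (b = 0 ∨ b = 1))

theorem InSquare.mem {a b : ℝ} (h : InSquare a b) :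
    (∀ k, 0 ≤ ![a, b] k ∧ ![a, b] k ≤ 1) ∧ ¬ ∀ k, ![a, b] k = 0 ∨ ![a, b] k = 1 := by
  simpa [Fin.forall_fin_two, InSquare, and_assoc] using h

theorem PuncturedSquare.inSquare (z : PuncturedSquare) : InSquare (z.1 0) (z.1 1) :=
  ⟨z.2.1 0, z.2.1 1, fun h => z.2.2 (Fin.forall_fin_two.2 h)⟩

open Classical in
/-- The point with coordinates `(a, b)` in the square `i`; its centre if there is no such point. -/
noncomputable def coordPt (O : Origami) (i : O.Square) (a b : ℝ) : O.Surface :=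
  if h : InSquare a b then O.pt i ⟨![a, b], h.mem⟩ else O.pt i centre

theorem coordPt_eq {i : O.Square} {a b : ℝ} (h : InSquare a b) :
    O.coordPt i a b = O.pt i ⟨![a, b], h.mem⟩ := dif_pos h

theorem pt_eq_coordPt (i : O.Square) (z : PuncturedSquare) :
    O.pt i z = O.coordPt i (z.1 0) (z.1 1) := by
  rw [coordPt_eq z.inSquare]
  congr 1
  exact Subtype.ext (funext (Fin.forall_fin_two.2 ⟨rfl, rfl⟩))

theorem proj_coordPt {i : O.Square} {a b : ℝ} (h : InSquare a b) :
    O.proj (O.coordPt i a b) = planeToTorus ![a, b] := by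
  rw [coordPt_eq h]; rfl

theorem exists_coordPt (x : O.Surface) : ∃ i a b, InSquare a b ∧ x = O.coordPt i a b := by
  obtain ⟨i, z, rfl⟩ := exists_pt x
  exact ⟨i, _, _, z.inSquare, pt_eq_coordPt i z⟩

theorem inSquare_left {a b : ℝ} (ha : 0 ≤ a ∧ a ≤ 1) (hb : 0 < b ∧ b < 1) : InSquare a b :=
  ⟨ha, ⟨hb.1.le, hb.2.le⟩, fun h => h.2.elim (fun h => hb.1.ne' h) fun h => hb.2.ne h⟩

theorem inSquare_right {a b : ℝ} (ha : 0 < a ∧ a < 1) (hb : 0 ≤ b ∧ b ≤ 1) : InSquare a b :=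
  ⟨⟨ha.1.le, ha.2.le⟩, hb, fun h => h.1.elim (fun h => ha.1.ne' h) fun h => ha.2.ne h⟩

theorem coordPt_right (i : O.Square) {b : ℝ} (hb : 0 < b ∧ b < 1) :
    O.coordPt i 1 b = O.coordPt (O.right i) 0 b := by
  rw [coordPt_eq (inSquare_left (by norm_num) hb), coordPt_eq (inSquare_left (by norm_num) hb)]
  exact Quot.sound (Glue.right i _ _ rfl rfl rfl)

theorem coordPt_up (i : O.Square) {a : ℝ} (ha : 0 < a ∧ a < 1) :
    O.coordPt i a 1 = O.coordPt (O.up i) a 0 := by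
  rw [coordPt_eq (inSquare_right ha (by norm_num)), coordPt_eq (inSquare_right ha (by norm_num))]
  exact Quot.sound (Glue.up i _ _ rfl rfl rfl)

theorem continuousOn_coordPt {Y : Type*} [TopologicalSpace Y] (i : O.Square) {f g : Y → ℝ}
    {s : Set Y} (hf : Continuous f) (hg : Continuous g) (h : ∀ y ∈ s, InSquare (f y) (g y)) :
    ContinuousOn (fun y => O.coordPt i (f y) (g y)) s := by
  rw [continuousOn_iff_continuous_domRestrict]
  have : s.domRestrict (fun y => O.coordPt i (f y) (g y)) =
      fun y : s => O.pt i ⟨![f y, g y], (h y y.2).mem⟩ := by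
    funext y
    exact coordPt_eq (h y y.2)
  rw [this]
  refine (continuous_pt i).comp (Continuous.subtype_mk ?_ _)
  refine continuous_pi (Fin.forall_fin_two.2 ⟨?_, ?_⟩)
  · exact hf.comp continuous_subtype_val
  · exact hg.comp continuous_subtype_val

theorem exists_continuous_map {β : Type*} [TopologicalSpace β] (F : O.Square → ℝ → ℝ → β)
    (hr : ∀ i b, 0 < b → b < 1 → F i 1 b = F (O.right i) 0 b)
    (hu : ∀ i a, 0 < a → a < 1 → F i a 1 = F (O.up i) a 0)
    (hF : ∀ i, Continuous fun z : PuncturedSquare => F i (z.1 0) (z.1 1)) :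
    ∃ f : O.Surface → β, Continuous f ∧ ∀ i a b, InSquare a b → f (O.coordPt i a b) = F i a b := by
  refine ⟨surfaceLift (fun i z => F i (z.1 0) (z.1 1)) ?_, continuous_surfaceLift hF,
    fun i a b h => ?_⟩
  · refine Fin.forall_fin_two.2 ⟨?_, ?_⟩
    · intro i z w hz hw hl
      have h1 := hl 1 (by decide)
      have h2 := PuncturedSquare.lt_of_ne (l := 1) (k := 0) (by decide) (Or.inr hz)
      change F i (z.1 0) (z.1 1) = F (O.right i) (w.1 0) (w.1 1)
      rw [← h1, hz, hw, hr i _ h2.1 h2.2]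
    · intro i z w hz hw hl
      have h1 := hl 0 (by decide)
      have h2 := PuncturedSquare.lt_of_ne (l := 0) (k := 1) (by decide) (Or.inr hz)
      change F i (z.1 0) (z.1 1) = F (O.up i) (w.1 0) (w.1 1)
      rw [← h1, hz, hw, hu i _ h2.1 h2.2]
  · rw [coordPt_eq h]
    rfl

/-- Continuity is required only on each closed piece, because `coordPt` takes a default value when
its coordinates leave the punctured square. -/
theorem continuous_ite_le_of_continuousOn {X Y : Type*} [TopologicalSpace X] [TopologicalSpace Y]
    {a b : X → ℝ} (ha : Continuous a) (hb : Continuous b) {f g : X → Y}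
    (hf : ContinuousOn f {x | a x ≤ b x}) (hg : ContinuousOn g {x | b x ≤ a x})
    (h : ∀ x, a x = b x → f x = g x) : Continuous fun x => if a x ≤ b x then f x else g x := by
  rw [← continuousOn_univ]
  have : (Set.univ : Set X) = {x | a x ≤ b x} ∪ {x | b x ≤ a x} := by
    ext x; simpa using le_total _ _
  rw [this]
  refine ContinuousOn.union_of_isClosed ?_ ?_ (isClosed_le ha hb) (isClosed_le hb ha)
  · exact hf.congr fun x hx => if_pos hx
  · refine hg.congr fun x hx => ?_
    split_ifs with h'
    · exact h x (le_antisymm h' hx)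
    · rfl

theorem mapGL_apply (A : SL(2, ℤ)) (k l : Fin 2) :
    (Matrix.SpecialLinearGroup.mapGL ℝ A).1 k l = (A.1 k l : ℝ) := by
  simp

theorem planeToTorus_eq_of_int {z w : Fin 2 → ℝ} (h : ∀ k, ∃ n : ℤ, z k = w k + n) :
    planeToTorus z = planeToTorus w :=
  funext fun k => (coe_eq_coe_iff _ _).2 (h k)

/-- The horizontal shear: `(r, u)` becomes `(r, u r⁻¹)`. -/
theorem lifts_T (h : O.Square ≃ O'.Square) (hr : ∀ i, h (O.right i) = O'.right (h i))
    (hu : ∀ i, h (O.up i) = O'.up (h (O.right i))) : Lifts ModularGroup.T O O' := by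
  have hr' : ∀ i, O.right.symm (h.symm i) = h.symm (O'.right.symm i) := fun i => by
    rw [Equiv.symm_apply_eq, Equiv.symm_apply_eq, hr, Equiv.apply_symm_apply,
      Equiv.apply_symm_apply]
  have hu' : ∀ i, O.up (O.right.symm (h.symm i)) = h.symm (O'.up i) := fun i => by
    rw [Equiv.eq_symm_apply, hu, Equiv.apply_symm_apply, Equiv.apply_symm_apply]
  -- The shear cuts each square along a + b = 1 and its inverse cuts along a = b. These four facts
  -- say that the triangles, translated back by integers, stay in the punctured square.
  have m1 : ∀ {a b : ℝ}, InSquare a b → a + b ≤ 1 → InSquare (a + b) b := by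
    rintro a b ⟨h1, h2, h3⟩ hab
    refine ⟨⟨by linarith, hab⟩, h2, ?_⟩
    rintro ⟨h4, h5 | h5⟩
    · subst h5; simp only [add_zero] at h4; exact h3 ⟨h4, Or.inl rfl⟩
    · exact h3 ⟨Or.inl (by linarith), Or.inr h5⟩
  have m2 : ∀ {a b : ℝ}, InSquare a b → 1 ≤ a + b → InSquare (a + b - 1) b := by
    rintro a b ⟨h1, h2, h3⟩ hab
    refine ⟨⟨by linarith, by linarith⟩, h2, ?_⟩
    rintro ⟨h4, h5 | h5⟩
    · exact h3 ⟨Or.inr (by linarith), Or.inl h5⟩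
    · subst h5; simp only [add_sub_cancel_right] at h4; exact h3 ⟨h4, Or.inr rfl⟩
  have m3 : ∀ {a b : ℝ}, InSquare a b → b ≤ a → InSquare (a - b) b := by
    rintro a b ⟨h1, h2, h3⟩ hab
    refine ⟨⟨by linarith, by linarith⟩, h2, ?_⟩
    rintro ⟨h4, h5 | h5⟩
    · subst h5; simp only [sub_zero] at h4; exact h3 ⟨h4, Or.inl rfl⟩
    · exact h3 ⟨Or.inr (by linarith), Or.inr h5⟩
  have m4 : ∀ {a b : ℝ}, InSquare a b → a ≤ b → InSquare (a - b + 1) b := by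
    rintro a b ⟨h1, h2, h3⟩ hab
    refine ⟨⟨by linarith, by linarith⟩, h2, ?_⟩
    rintro ⟨h4, h5 | h5⟩
    · exact h3 ⟨Or.inl (by linarith), Or.inl h5⟩
    · subst h5; simp only [sub_add_cancel] at h4; exact h3 ⟨h4, Or.inr rfl⟩
  have c0 := continuous_coord 0
  have c1 := continuous_coord 1
  obtain ⟨F, hF, hF'⟩ := exists_continuous_map (O := O) (β := O'.Surface)
    (fun i a b => if a + b ≤ 1 then O'.coordPt (h i) (a + b) b else
      O'.coordPt (O'.right (h i)) (a + b - 1) b)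
    (by
      intro i b h0 h1
      rw [if_neg (by linarith), if_pos (by linarith), hr, zero_add, add_sub_cancel_left])
    (by
      intro i a h0 h1
      rw [if_neg (by linarith), if_pos (by linarith), hu, add_sub_cancel_right, add_zero, hr,
        coordPt_up _ ⟨h0, h1⟩])
    (by
      intro i
      refine continuous_ite_le_of_continuousOn (c0.add c1) continuous_const
        (continuousOn_coordPt _ (c0.add c1) c1 fun z hz => m1 z.inSquare hz)
        (continuousOn_coordPt _ ((c0.add c1).sub continuous_const) c1
          fun z hz => m2 z.inSquare hz) fun z hz => ?_
      replace hz : z.1 0 + z.1 1 = 1 := hz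
      have hb : 0 < z.1 1 ∧ z.1 1 < 1 := by
        have h1 := z.inSquare
        have h2 := h1.2.1
        refine ⟨lt_of_le_of_ne h2.1 fun h => h1.2.2 ⟨Or.inr (by linarith), Or.inl h.symm⟩,
          lt_of_le_of_ne h2.2 fun h => h1.2.2 ⟨Or.inl (by linarith), Or.inr h⟩⟩
      rw [hz, sub_self, coordPt_right _ hb])
  obtain ⟨G, hG, hG'⟩ := exists_continuous_map (O := O') (β := O.Surface)
    (fun i a b => if b ≤ a then O.coordPt (h.symm i) (a - b) b else
      O.coordPt (O.right.symm (h.symm i)) (a - b + 1) b)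
    (by
      intro i b h0 h1
      rw [if_pos h1.le, if_neg (by linarith), hr', Equiv.symm_apply_apply]
      congr 1
      ring)
    (by
      intro i a h0 h1
      rw [if_neg (by linarith), if_pos h0.le, sub_add_cancel, sub_zero, coordPt_up _ ⟨h0, h1⟩,
        hu'])
    (by
      intro i
      refine continuous_ite_le_of_continuousOn c1 c0
        (continuousOn_coordPt _ (c0.sub c1) c1 fun z hz => m3 z.inSquare hz)
        (continuousOn_coordPt _ ((c0.sub c1).add continuous_const) c1
          fun z hz => m4 z.inSquare hz) fun z hz => ?_
      have hb : 0 < z.1 1 ∧ z.1 1 < 1 := by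
        have h1 := z.inSquare
        have h2 := h1.2.1
        refine ⟨lt_of_le_of_ne h2.1 fun h => h1.2.2 ⟨Or.inl (by linarith), Or.inl h.symm⟩,
          lt_of_le_of_ne h2.2 fun h => h1.2.2 ⟨Or.inr (by linarith), Or.inr h⟩⟩
      rw [hz, sub_self, zero_add, coordPt_right _ (hz ▸ hb), Equiv.apply_symm_apply])
  refine ⟨⟨⟨F, G, fun x => ?_, fun x => ?_⟩, hF, hG⟩, fun x => ?_⟩
  · obtain ⟨i, a, b, hab, rfl⟩ := exists_coordPt x
    rw [hF' _ _ _ hab]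
    split_ifs with h1
    · rw [hG' _ _ _ (m1 hab h1), if_pos (by linarith [hab.1.1]), Equiv.symm_apply_apply,
        add_sub_cancel_right]
    · rw [not_le] at h1
      rw [hG' _ _ _ (m2 hab h1.le), ← hr, Equiv.symm_apply_apply]
      -- The two closed branches meet only at a = 1, where the right edge has to be identified with
      -- the left edge of the next square.
      split_ifs with h2
      · have ha : a = 1 := le_antisymm hab.1.2 (by linarith)
        subst ha
        have hb : 0 < b ∧ b < 1 := ⟨by linarith, lt_of_le_of_ne hab.2.1.2 fun h =>
          hab.2.2 ⟨Or.inr rfl, Or.inr h⟩⟩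
        rw [coordPt_right _ hb]
        congr 1
        ring
      · rw [Equiv.symm_apply_apply]
        congr 1
        ring
  · obtain ⟨i, a, b, hab, rfl⟩ := exists_coordPt x
    rw [hG' _ _ _ hab]
    split_ifs with h1
    · rw [hF' _ _ _ (m3 hab h1), if_pos (by linarith [hab.1.2]), Equiv.apply_symm_apply,
        sub_add_cancel]
    · rw [not_le] at h1
      rw [hF' _ _ _ (m4 hab h1.le), hr', Equiv.apply_symm_apply, Equiv.apply_symm_apply]
      split_ifs with h2
      · have ha : a = 0 := le_antisymm (by linarith) hab.1.1
        subst ha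
        have hb : 0 < b ∧ b < 1 := ⟨by linarith, lt_of_le_of_ne hab.2.1.2 fun h =>
          hab.2.2 ⟨Or.inl rfl, Or.inr h⟩⟩
        have : (0 : ℝ) - b + 1 + b = 1 := by ring
        rw [this, coordPt_right _ hb, Equiv.apply_symm_apply]
      · congr 1
        ring
  · obtain ⟨i, a, b, hab, rfl⟩ := exists_coordPt x
    change O'.proj (F _) = _
    rw [proj_coordPt hab, ← planeToTorus_mulVec, hF' _ _ _ hab]
    have hT : (Matrix.SpecialLinearGroup.mapGL ℝ ModularGroup.T).1.mulVec ![a, b] =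
        ![a + b, b] := by
      funext k
      fin_cases k <;> 
        simp only [Matrix.mulVec, dotProduct, Fin.sum_univ_two, mapGL_apply] <;>
        simp [ModularGroup.T]
    rw [hT]
    split_ifs with h1
    · rw [proj_coordPt (m1 hab h1)]
    · rw [not_le] at h1
      rw [proj_coordPt (m2 hab h1.le)]
      exact planeToTorus_eq_of_int (Fin.forall_fin_two.2 ⟨⟨-1, by simp; ring⟩, ⟨0, by simp⟩⟩)

/-- The quarter turn: `(r, u)` becomes `(u⁻¹, r)`. -/
theorem lifts_S (h : O.Square ≃ O'.Square) (hr : ∀ i, h (O.right i) = O'.up (h i))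
    (hu : ∀ i, O'.right (h (O.up i)) = h i) : Lifts ModularGroup.S O O' := by
  have m1 : ∀ {a b : ℝ}, InSquare a b → InSquare (1 - b) a := by
    rintro a b ⟨h1, h2, h3⟩
    refine ⟨⟨by linarith, by linarith⟩, h1, ?_⟩
    rintro ⟨h4, h5⟩
    exact h3 ⟨h5, h4.symm.imp (fun h => by linarith) fun h => by linarith⟩
  have m2 : ∀ {a b : ℝ}, InSquare a b → InSquare b (1 - a) := by
    rintro a b ⟨h1, h2, h3⟩
    refine ⟨h2, ⟨by linarith, by linarith⟩, ?_⟩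
    rintro ⟨h4, h5⟩
    exact h3 ⟨h5.symm.imp (fun h => by linarith) fun h => by linarith, h4⟩
  have c0 := continuous_coord 0
  have c1 := continuous_coord 1
  obtain ⟨F, hF, hF'⟩ := exists_continuous_map (O := O) (β := O'.Surface)
    -- The rotation gives (-b, a); adding 1 brings it back to the unit square.
    (fun i a b => O'.coordPt (h i) (1 - b) a)
    (by
      intro i b h0 h1
      rw [hr, coordPt_up _ ⟨by linarith, by linarith⟩])
    (by
      intro i a h0 h1
      rw [sub_self, sub_zero, coordPt_right _ ⟨h0, h1⟩, hu])
    (by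
      intro i
      rw [← continuousOn_univ]
      exact continuousOn_coordPt _ (continuous_const.sub c1) c0 fun z _ => m1 z.inSquare)
  obtain ⟨G, hG, hG'⟩ := exists_continuous_map (O := O') (β := O.Surface)
    (fun i a b => O.coordPt (h.symm i) b (1 - a))
    (by
      intro i b h0 h1
      have : h.symm i = O.up (h.symm (O'.right i)) := by
        rw [Equiv.symm_apply_eq, ← O'.right.injective.eq_iff, hu, Equiv.apply_symm_apply]
      rw [sub_self, sub_zero, coordPt_up _ ⟨h0, h1⟩, this])
    (by
      intro i a h0 h1
      have : h.symm (O'.up i) = O.right (h.symm i) := by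
        rw [Equiv.symm_apply_eq, hr, Equiv.apply_symm_apply]
      rw [coordPt_right _ ⟨by linarith, by linarith⟩, this])
    (by
      intro i
      rw [← continuousOn_univ]
      exact continuousOn_coordPt _ c1 (continuous_const.sub c0) fun z _ => m2 z.inSquare)
  refine ⟨⟨⟨F, G, fun x => ?_, fun x => ?_⟩, hF, hG⟩, fun x => ?_⟩
  · obtain ⟨i, a, b, hab, rfl⟩ := exists_coordPt x
    rw [hF' _ _ _ hab, hG' _ _ _ (m1 hab), Equiv.symm_apply_apply, sub_sub_cancel]
  · obtain ⟨i, a, b, hab, rfl⟩ := exists_coordPt x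
    rw [hG' _ _ _ hab, hF' _ _ _ (m2 hab), Equiv.apply_symm_apply, sub_sub_cancel]
  · obtain ⟨i, a, b, hab, rfl⟩ := exists_coordPt x
    change O'.proj (F _) = _
    rw [proj_coordPt hab, ← planeToTorus_mulVec, hF' _ _ _ hab, proj_coordPt (m1 hab)]
    have hS : (Matrix.SpecialLinearGroup.mapGL ℝ ModularGroup.S).1.mulVec ![a, b] =
        ![-b, a] := by
      funext k
      fin_cases k <;> 
        simp only [Matrix.mulVec, dotProduct, Fin.sum_univ_two, mapGL_apply] <;>
        simp [ModularGroup.S]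
    rw [hS]
    exact planeToTorus_eq_of_int (Fin.forall_fin_two.2 ⟨⟨1, by simp; ring⟩, ⟨0, by simp⟩⟩)

end Origami

/-! ### Affine homeomorphisms are lifts of integral automorphisms of the torus. -/

namespace Origami

open TorusCover

variable {O : Origami}

/-- `A` applied to a chart at `x`, and a chart at `f x` composed with `f`, are both charts for
`O.proj ∘ f`; hence they differ locally by a translation. -/
theorem Lifts.mem_veechGroup {A : SL(2, ℤ)} (h : Lifts A O O) :
    Matrix.SpecialLinearGroup.mapGL ℝ A ∈ O.veechGroup := by
  obtain ⟨f, hf⟩ := h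
  have hdet : (Matrix.SpecialLinearGroup.mapGL ℝ A).1.det = 1 := by
    have h1 := A.det_coe
    rw [Matrix.det_fin_two] at h1 ⊢
    simp only [mapGL_apply]
    exact_mod_cast h1
  refine ⟨by rw [hdet]; exact one_pos, f, fun x => ?_⟩
  obtain ⟨φ, U, hU, hφ, hφp⟩ := exists_isChartAt O.continuous_proj x
  obtain ⟨ψ, V, hV, hψ, hψp⟩ := exists_isChartAt O.continuous_proj (f x)
  refine ⟨φ, ψ, ⟨U, hU, hφ, hφp⟩, ⟨V, hV, hψ, hψp⟩, ?_⟩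
  have h1 : IsChartAt (O.proj ∘ f) x
      fun y => (Matrix.SpecialLinearGroup.mapGL ℝ A).1.mulVec (φ y) := by
    refine ⟨U, hU, ?_, fun y hy => ?_⟩
    · exact (Continuous.matrix_mulVec continuous_const continuous_id).comp_continuousOn hφ
    · rw [planeToTorus_mulVec, hφp y hy, ← hf]
      rfl
  have h2 : IsChartAt (O.proj ∘ f) x (ψ ∘ f) :=
    ⟨f ⁻¹' V, f.continuous.continuousAt hV, hψ.comp f.continuous.continuousOn fun _ => id,
      fun y hy => hψp _ hy⟩
  exact h1.eventually_eq_add h2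

/-- In a square, an affine homeomorphism is given by a single affine map. -/
theorem exists_proj_affine {f : O.Surface ≃ₜ O.Surface} {X : GL (Fin 2) ℝ}
    (hf : IsAffineWith O.proj f X) (i : O.Square) :
    ∃ c, ∀ z : PuncturedSquare, O.proj (f (O.pt i z)) = planeToTorus (X.1.mulVec z.1) + c := by
  have hloc : IsLocallyConstant fun z : PuncturedSquare =>
      O.proj (f (O.pt i z)) - planeToTorus (X.1.mulVec z.1) := by
    refine (IsLocallyConstant.iff_eventually_eq _).2 fun z => ?_
    obtain ⟨φ, ψ, ⟨U, hU, hφ, hφp⟩, ⟨V, hV, hψ, hψp⟩, z₀, hz₀⟩ := hf (O.pt i z)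
    have cp : ContinuousAt (O.pt i) z := (continuous_pt i).continuousAt
    have h1 : IsChartAt (O.proj ∘ O.pt i) z (φ ∘ O.pt i) :=
      ⟨O.pt i ⁻¹' U, cp hU, hφ.comp (continuous_pt i).continuousOn fun _ => id,
        fun y hy => hφp _ hy⟩
    have h2 : IsChartAt (O.proj ∘ O.pt i) z (fun y : PuncturedSquare => y.1) :=
      ⟨Set.univ, univ_mem, continuous_subtype_val.continuousOn, fun y _ => rfl⟩
    obtain ⟨c, hc⟩ := h2.eventually_eq_add h1
    have key : ∀ᶠ y : PuncturedSquare in 𝓝 z,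
        O.proj (f (O.pt i y)) - planeToTorus (X.1.mulVec y.1) =
          planeToTorus (X.1.mulVec c + z₀) := by
      filter_upwards [hc, cp.eventually hz₀, (f.continuous.continuousAt.comp cp) hV]
        with y hy1 hy2 hy3
      simp only [Function.comp_apply] at hy1
      rw [← hψp (f (O.pt i y)) hy3, hy2, hy1, Matrix.mulVec_add, add_assoc,
        planeToTorus_add (X.1.mulVec y.1), add_sub_cancel_left]
    filter_upwards [key] with y hy
    rw [hy, key.self_of_nhds]
  refine ⟨O.proj (f (O.pt i centre)) - planeToTorus (X.1.mulVec centre.1), fun z => ?_⟩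
  rw [← hloc.apply_eq_of_preconnectedSpace z centre]
  simp

/-- Affine homeomorphisms extend to the corners of the squares. -/
theorem proj_affine_corner {f : O.Surface ≃ₜ O.Surface} {X : GL (Fin 2) ℝ} {i : O.Square}
    {c : UnitAddTorus (Fin 2)}
    (hc : ∀ z : PuncturedSquare, O.proj (f (O.pt i z)) = planeToTorus (X.1.mulVec z.1) + c)
    {q : Fin 2 → ℝ} (hq : ∀ k, q k = 0 ∨ q k = 1) : planeToTorus (X.1.mulVec q) + c = 0 := by
  have := O.finite
  -- Interior points `z n` tend to the corner `q`. If the image limit on the torus were nonzero, the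
  -- images would accumulate at a point of the surface. Applying `f.symm` there would give a point
  -- of the surface over 0, which does not exist.
  by_contra hne
  let z : ℕ → Fin 2 → ℝ := fun n k => q k + (1 / ((n : ℝ) + 2)) * (1 / 2 - q k)
  have hz : ∀ n, (∀ k, 0 ≤ z n k ∧ z n k ≤ 1) ∧ ¬ ∀ k, z n k = 0 ∨ z n k = 1 := by
    intro n
    have h0 : (0 : ℝ) < 1 / ((n : ℝ) + 2) := by positivity
    have h1 : (1 : ℝ) / ((n : ℝ) + 2) < 1 := by
      rw [div_lt_one (by positivity)]
      linarith [n.cast_nonneg (α := ℝ)]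
    have hk : ∀ k, 0 < z n k ∧ z n k < 1 := by
      intro k
      rcases hq k with h | h <;> simp only [z, h] <;> constructor <;> linarith
    exact ⟨fun k => ⟨(hk k).1.le, (hk k).2.le⟩,
      fun h => (h 0).elim (fun h => (hk 0).1.ne' h) fun h => (hk 0).2.ne h⟩
  have hzq : Tendsto z atTop (𝓝 q) := by
    refine tendsto_pi_nhds.2 fun k => ?_
    have h1 : Tendsto (fun n : ℕ => (1 : ℝ) / ((n : ℝ) + 2)) atTop (𝓝 0) := by
      simpa using (tendsto_const_nhds (x := (1 : ℝ))).div_atTop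
        (tendsto_atTop_add_const_right _ (2 : ℝ) tendsto_natCast_atTop_atTop)
    simpa [z] using (h1.mul_const (1 / 2 - q k)).const_add (q k)
  let a : ℕ → PuncturedSquare := fun n => ⟨z n, hz n⟩
  choose j w hjw using fun n => exists_pt (f (O.pt i (a n)))
  -- Along an ultrafilter the finitely many square labels stabilise and the coordinates converge,
  -- with no passage to subsequences.
  let U : Ultrafilter ℕ := hyperfilter ℕ
  have hU : (U : Filter ℕ) ≤ atTop := Nat.hyperfilter_le_atTop
  obtain ⟨j₀, hj₀⟩ := (U.map j).eq_pure_of_finite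
  have hj : ∀ᶠ n in (U : Filter ℕ), j n = j₀ := by
    have : {j₀} ∈ U.map j := by rw [hj₀]; exact rfl
    exact this
  obtain ⟨w₀, hw₀, hw⟩ := (isCompact_univ_pi fun _ : Fin 2 =>
    isCompact_Icc (a := (0 : ℝ)) (b := 1)).ultrafilter_le_nhds (U.map fun n => (w n).1) (by
      rw [le_principal_iff]
      exact mem_map.2 (univ_mem' fun n k _ => (w n).2.1 k))
  replace hw : Tendsto (fun n => (w n).1) U (𝓝 w₀) := hw
  have hlim : planeToTorus w₀ = planeToTorus (X.1.mulVec q) + c := by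
    refine tendsto_nhds_unique ((continuous_planeToTorus.tendsto w₀).comp hw) ?_
    have h1 : Tendsto (fun y => planeToTorus (X.1.mulVec y) + c) (𝓝 q)
        (𝓝 (planeToTorus (X.1.mulVec q) + c)) :=
      ((continuous_planeToTorus.comp
        (Continuous.matrix_mulVec continuous_const continuous_id)).add continuous_const).tendsto q
    refine (h1.comp (hzq.mono_left hU)).congr fun n => ?_
    have := hc (a n)
    rw [hjw n] at this
    exact this.symm
  have hmem : (∀ k, 0 ≤ w₀ k ∧ w₀ k ≤ 1) ∧ ¬ ∀ k, w₀ k = 0 ∨ w₀ k = 1 := by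
    refine ⟨fun k => hw₀ k trivial, fun h => hne ?_⟩
    rw [← hlim]
    exact funext fun k => (coe_eq_zero_iff_of_mem (hw₀ k trivial)).2 (h k)
  let b : PuncturedSquare := ⟨w₀, hmem⟩
  have hwb : Tendsto w U (𝓝 b) := tendsto_subtype_rng.2 hw
  have h1 : Tendsto (fun n => f (O.pt i (a n))) U (𝓝 (O.pt j₀ b)) := by
    refine (((continuous_pt j₀).tendsto b).comp hwb).congr' ?_
    filter_upwards [hj] with n hn
    rw [hjw n, hn]
    rfl
  have h2 : Tendsto (fun n => O.proj (O.pt i (a n))) U (𝓝 (O.proj (f.symm (O.pt j₀ b)))) := by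
    refine (((O.continuous_proj.comp f.symm.continuous).tendsto _).comp h1).congr fun n => ?_
    simp
  have h3 : Tendsto (fun n => O.proj (O.pt i (a n))) U (𝓝 (planeToTorus q)) :=
    (continuous_planeToTorus.tendsto q).comp (hzq.mono_left hU)
  refine proj_ne_zero _ ((tendsto_nhds_unique h2 h3).trans (funext fun k => ?_))
  rcases hq k with h | h <;> simp [planeToTorus, h]

theorem proj_affine {f : O.Surface ≃ₜ O.Surface} {X : GL (Fin 2) ℝ}
    (hf : IsAffineWith O.proj f X) (i : O.Square) (z : PuncturedSquare) :
    O.proj (f (O.pt i z)) = planeToTorus (X.1.mulVec z.1) := by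
  obtain ⟨c, hc⟩ := exists_proj_affine hf i
  have := proj_affine_corner hc (q := 0) fun k => Or.inl rfl
  have h0 : planeToTorus (X.1.mulVec 0) = 0 := by
    rw [Matrix.mulVec_zero]
    funext k
    simp [planeToTorus]
  rw [h0, zero_add] at this
  rw [hc, this, add_zero]

/-- The standard basis vectors are corners, so the columns of `X` vanish on the torus. -/
theorem exists_int_of_affine {f : O.Surface ≃ₜ O.Surface} {X : GL (Fin 2) ℝ}
    (hf : IsAffineWith O.proj f X) : ∃ M : Matrix (Fin 2) (Fin 2) ℤ, X.1 = M.map (Int.cast) := by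
  obtain ⟨i⟩ := O.nonempty
  have key : ∀ k l, ∃ n : ℤ, X.1 k l = n := by
    intro k l
    have h := proj_affine_corner (c := 0) (i := i) (q := Pi.single l 1)
      (fun z => by rw [proj_affine hf, add_zero]) fun m => by
        by_cases h : m = l
        · subst h; simp
        · simp [h]
    have := congrFun h k
    simp only [Matrix.mulVec_single_one, add_zero] at this
    exact (coe_eq_zero_iff' _).1 this
  choose M hM using key
  exact ⟨Matrix.of M, Matrix.ext fun k l => by simp [hM]⟩

/-- Both `X` and its inverse are integral, so the determinant is a unit of ℤ; orientation makes it
1. -/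
theorem exists_lifts_of_mem {X : GL (Fin 2) ℝ} (h : X ∈ O.veechGroup) :
    ∃ A : SL(2, ℤ), Matrix.SpecialLinearGroup.mapGL ℝ A = X ∧ Lifts A O O := by
  obtain ⟨hdet, f, hf⟩ := h
  obtain ⟨M, hM⟩ := exists_int_of_affine hf
  obtain ⟨N, hN⟩ := exists_int_of_affine hf.symm
  have hdetM : M.det = 1 := by
    have h1 : X.1.det * (X⁻¹).1.det = 1 := by
      rw [← Matrix.det_mul, Units.mul_inv, Matrix.det_one]
    have e : ∀ M : Matrix (Fin 2) (Fin 2) ℤ, (M.map (Int.cast : ℤ → ℝ)).det = (M.det : ℝ) := by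
      intro M
      simp [Matrix.det_fin_two]
    rw [hM, hN, e, e] at h1
    rw [hM, e] at hdet
    have h2 : M.det * N.det = 1 := by exact_mod_cast h1
    have h3 : 0 < M.det := by exact_mod_cast hdet
    rcases Int.eq_one_or_neg_one_of_mul_eq_one h2 with h | h <;> omega
  let A : SL(2, ℤ) := ⟨M, hdetM⟩
  have hA : Matrix.SpecialLinearGroup.mapGL ℝ A = X := by
    refine Units.ext (Matrix.ext fun k l => ?_)
    rw [mapGL_apply, hM]
    rfl
  refine ⟨A, hA, f, fun x => ?_⟩
  obtain ⟨i, z, rfl⟩ := exists_pt x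
  rw [proj_affine hf, ← hA, planeToTorus_mulVec]
  rfl

theorem mapGL_injective : Function.Injective
    (Matrix.SpecialLinearGroup.mapGL ℝ : SL(2, ℤ) →* GL (Fin 2) ℝ) := by
  intro A B h
  refine Matrix.SpecialLinearGroup.ext _ _ fun k l => ?_
  have := congrArg (fun X : GL (Fin 2) ℝ => X.1 k l) h
  simp only [mapGL_apply] at this
  exact_mod_cast this

theorem mapGL_mem_veechGroup {A : SL(2, ℤ)} :
    Matrix.SpecialLinearGroup.mapGL ℝ A ∈ O.veechGroup ↔ Lifts A O O := by
  refine ⟨fun h => ?_, Lifts.mem_veechGroup⟩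
  obtain ⟨B, hB, hl⟩ := exists_lifts_of_mem h
  rwa [← mapGL_injective hB]

end Origami

/-! ### Monodromy, automorphisms of the free group and Veech groups. -/

namespace Origami

variable {O O' : Origami}

/-- The monodromy action of the fundamental group of the once punctured torus. -/
def monodromy (O : Origami) : FreeGroup (Fin 2) →* Equiv.Perm O.Square := FreeGroup.lift O.side

@[simp]
theorem monodromy_of (k : Fin 2) : O.monodromy (FreeGroup.of k) = O.side k :=
  FreeGroup.lift_apply_of

theorem exists_monodromy (i j : O.Square) : ∃ w, O.monodromy w i = j := by
  obtain ⟨g, hg, rfl⟩ := O.connected i j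
  have : {O.right, O.up} = Set.range O.side := by
    simp [side, Matrix.range_cons, Set.pair_comm]
  rw [this, ← FreeGroup.range_lift_eq_closure] at hg
  obtain ⟨w, rfl⟩ := hg
  exact ⟨w, rfl⟩

/-- The origami whose monodromy is composed with an automorphism of the free group. -/
abbrev twist (O : Origami) (φ : MulAut (FreeGroup (Fin 2))) : Origami where
  Square := O.Square
  finite := O.finite
  nonempty := O.nonempty
  right := O.monodromy (φ (FreeGroup.of 0))
  up := O.monodromy (φ (FreeGroup.of 1))
  connected i j := by
    obtain ⟨w, hw⟩ := exists_monodromy i j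
    refine ⟨O.monodromy w, ?_, hw⟩
    have h : {O.monodromy (φ (FreeGroup.of 0)), O.monodromy (φ (FreeGroup.of 1))} =
        Set.range fun k : Fin 2 => O.monodromy (φ (FreeGroup.of k)) := by
      ext g
      simp [eq_comm]
    rw [h, ← FreeGroup.range_lift_eq_closure]
    refine ⟨φ⁻¹ w, ?_⟩
    have : FreeGroup.lift (fun k : Fin 2 => O.monodromy (φ (FreeGroup.of k))) =
        O.monodromy.comp φ.toMonoidHom := by
      ext k : 1
      simp
    rw [this]
    simp

theorem side_twist (φ : MulAut (FreeGroup (Fin 2))) (k : Fin 2) :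
    (O.twist φ).side k = O.monodromy (φ (FreeGroup.of k)) := by
  fin_cases k <;> rfl

theorem monodromy_twist (φ : MulAut (FreeGroup (Fin 2))) (w : FreeGroup (Fin 2)) :
    (O.twist φ).monodromy w = O.monodromy (φ w) := by
  have : (O.twist φ).monodromy = O.monodromy.comp φ.toMonoidHom := by
    ext k : 1
    rw [monodromy_of, side_twist]
    rfl
  rw [this]
  rfl

/-- The automorphism `φ` of the free group belongs to `A ∈ SL₂(ℤ)`. -/
def Induces (A : SL(2, ℤ)) (φ : MulAut (FreeGroup (Fin 2))) : Prop :=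
  ∀ O : Origami, Lifts A O (O.twist φ)

/-- Twisting acts by precomposition: `φ` followed by `ψ` gives `w ↦ φ (ψ w)`. The matrices therefore
multiply in the opposite order. -/
theorem Induces.mul {A B : SL(2, ℤ)} {φ ψ : MulAut (FreeGroup (Fin 2))} (hA : Induces A φ)
    (hB : Induces B ψ) : Induces (B * A) (φ * ψ) := by
  intro O
  have h : Iso ((O.twist φ).twist ψ) (O.twist (φ * ψ)) :=
    ⟨Equiv.refl _, fun k i => by rw [side_twist, side_twist, monodromy_twist]; rfl⟩
  simpa using ((hA O).trans (hB _)).trans h.lifts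

theorem Induces.inv {A : SL(2, ℤ)} {φ : MulAut (FreeGroup (Fin 2))} (hA : Induces A φ) :
    Induces A⁻¹ φ⁻¹ := by
  intro O
  have h : Iso ((O.twist φ⁻¹).twist φ) O :=
    ⟨Equiv.refl _, fun k i => by rw [side_twist, monodromy_twist]; simp⟩
  simpa using ((hA (O.twist φ⁻¹)).trans h.lifts).symm

theorem induces_one : Induces 1 1 := fun O =>
  Iso.lifts ⟨Equiv.refl _, fun k i => by rw [side_twist]; simp⟩

/-- The automorphism `a ↦ a`, `b ↦ b a⁻ˢ` of the free group. -/
def shear (s : ℤ) : MulAut (FreeGroup (Fin 2)) :=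
  MonoidHom.toMulEquiv
    (FreeGroup.lift ![FreeGroup.of 0, FreeGroup.of 1 * FreeGroup.of 0 ^ (-s)])
    (FreeGroup.lift ![FreeGroup.of 0, FreeGroup.of 1 * FreeGroup.of 0 ^ s])
    (by ext k : 1; fin_cases k <;> simp)
    (by ext k : 1; fin_cases k <;> simp)

theorem shear_of_zero (s : ℤ) : shear s (FreeGroup.of 0) = FreeGroup.of 0 := by
  simp [shear]

theorem shear_of_one (s : ℤ) :
    shear s (FreeGroup.of 1) = FreeGroup.of 1 * FreeGroup.of 0 ^ (-s) := by
  simp [shear]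

/-- The automorphism `a ↦ b⁻¹`, `b ↦ a` of the free group. -/
def quarterTurn : MulAut (FreeGroup (Fin 2)) :=
  MonoidHom.toMulEquiv
    (FreeGroup.lift ![(FreeGroup.of 1)⁻¹, FreeGroup.of 0])
    (FreeGroup.lift ![FreeGroup.of 1, (FreeGroup.of 0)⁻¹])
    (by ext k : 1; fin_cases k <;> simp)
    (by ext k : 1; fin_cases k <;> simp)

theorem induces_shear (s : ℤ) : Induces (ModularGroup.T ^ s) (shear s) := by
  have hom : ∀ s t, shear s * shear t = shear (s + t) := by
    intro s t
    have : (shear s * shear t).toMonoidHom = (shear (s + t)).toMonoidHom := by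
      ext k : 1
      fin_cases k
      · simp [shear_of_zero]
      · simp [shear_of_one, shear_of_zero, mul_assoc, add_comm, zpow_add]
    exact MulEquiv.ext fun w => DFunLike.congr_fun this w
  have h0 : shear 0 = 1 := by
    have h := hom 0 0
    rw [add_zero] at h
    exact mul_eq_left.1 h
  have h1 : Induces ModularGroup.T (shear 1) := fun O => by
    refine lifts_T (Equiv.refl _) (fun i => ?_) fun i => ?_
    · simp [shear_of_zero, side]
    · simp [shear_of_one, side]
  induction s using Int.induction_on with
  | zero => rw [zpow_zero, h0]; exact induces_one
  | succ n ih =>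
    rw [add_comm, zpow_add, zpow_one, add_comm, ← hom]
    exact ih.mul h1
  | pred n ih =>
    have h2 : shear (-1) = (shear 1)⁻¹ := eq_inv_of_mul_eq_one_left (by rw [hom]; exact h0)
    have h3 : -(n : ℤ) - 1 = -1 + -n := by ring
    rw [sub_eq_add_neg, ← hom, ← sub_eq_add_neg, h3, zpow_add, zpow_neg_one, h2]
    exact ih.mul h1.inv

theorem induces_quarterTurn : Induces ModularGroup.S quarterTurn := fun O => by
  refine lifts_S (Equiv.refl _) (fun i => ?_) fun i => ?_
  · simp [quarterTurn, side]
  · simp [quarterTurn, side]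

theorem exists_induces (A : SL(2, ℤ)) : ∃ φ, Induces A φ := by
  have hA : A ∈ Subgroup.closure {ModularGroup.S, ModularGroup.T} := by
    rw [SpecialLinearGroup.SL2Z_generators]
    trivial
  induction hA using Subgroup.closure_induction with
  | mem x hx =>
    rcases hx with rfl | rfl
    · exact ⟨_, induces_quarterTurn⟩
    · exact ⟨_, by simpa using induces_shear 1⟩
  | one => exact ⟨_, induces_one⟩
  | mul x y _ _ hx hy =>
    obtain ⟨φ, hφ⟩ := hx
    obtain ⟨ψ, hψ⟩ := hy
    exact ⟨_, hψ.mul hφ⟩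
  | inv x _ hx =>
    obtain ⟨φ, hφ⟩ := hx
    exact ⟨_, hφ.inv⟩

/-- The Veech group in terms of the monodromy. -/
theorem mem_veechGroup_iff {A : SL(2, ℤ)} {φ : MulAut (FreeGroup (Fin 2))} (hA : Induces A φ) :
    Matrix.SpecialLinearGroup.mapGL ℝ A ∈ O.veechGroup ↔
      ∃ h : Equiv.Perm O.Square, ∀ k i,
        h (O.side k i) = O.monodromy (φ (FreeGroup.of k)) (h i) := by
  rw [mapGL_mem_veechGroup]
  constructor
  · intro h
    -- Composing with the universal lift of `A` cancels the matrix and leaves an isomorphism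
    -- problem.
    have h1 : Lifts 1 O (O.twist φ) := by simpa using h.symm.trans (hA O)
    obtain ⟨h, hh⟩ := h1.iso
    exact ⟨h, fun k i => by rw [hh, side_twist]⟩
  · rintro ⟨h, hh⟩
    have h1 : Iso O (O.twist φ) := ⟨h, fun k i => by rw [hh, side_twist]⟩
    simpa using (hA O).trans h1.symm.lifts

theorem map_monodromy {φ : MulAut (FreeGroup (Fin 2))} {h : O.Square → O'.Square}
    (hh : ∀ k i, h (O.side k i) = O'.monodromy (φ (FreeGroup.of k)) (h i))
    (w : FreeGroup (Fin 2)) : ∀ i, h (O.monodromy w i) = O'.monodromy (φ w) (h i) := by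
  induction w using FreeGroup.induction_on with
  | C1 => simp
  | of k => simpa using hh k
  | inv_of k ih =>
    intro i
    have := ih ((O.monodromy (FreeGroup.of k))⁻¹ i)
    rw [Equiv.Perm.coe_inv, Equiv.apply_symm_apply] at this
    rw [map_inv, map_inv, map_inv, this, Equiv.Perm.coe_inv, Equiv.Perm.coe_inv,
      Equiv.symm_apply_apply]
  | mul v w hv hw =>
    intro i
    rw [map_mul, map_mul, map_mul, Equiv.Perm.mul_apply, Equiv.Perm.mul_apply, hv, hw]

theorem T_zpow_mem_veechGroup_iff {s : ℤ} :
    Matrix.SpecialLinearGroup.mapGL ℝ (ModularGroup.T ^ s) ∈ O.veechGroup ↔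
      ∃ h : Equiv.Perm O.Square, (∀ i, h (O.right i) = O.right (h i)) ∧
        ∀ i, h (O.up i) = O.up ((O.right ^ (-s)) (h i)) := by
  rw [mem_veechGroup_iff (induces_shear s)]
  simp [Fin.forall_fin_two, shear_of_zero, shear_of_one, side]

/-- A covering of origamis whose deck group is a subgroup of the cyclic group of all translations
of the upper origami induces an inclusion of Veech groups. -/
theorem veechGroup_le_of_cover (π : O'.Square → O.Square) (hπ : Function.Surjective π)
    (hside : ∀ k i, π (O'.side k i) = O.side k (π i)) (σ : Equiv.Perm O'.Square)
    (hσ : ∀ k i, σ (O'.side k i) = O'.side k (σ i))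
    (hcent : ∀ g : Equiv.Perm O'.Square, (∀ k i, g (O'.side k i) = O'.side k (g i)) →
      ∃ a : ℤ, g = σ ^ a)
    (n : ℤ) (hfib : ∀ i j, π i = π j ↔ ∃ t : ℤ, j = (σ ^ (n * t)) i) :
    O'.veechGroup ≤ O.veechGroup := by
  intro X hX
  obtain ⟨A, rfl, -⟩ := exists_lifts_of_mem hX
  obtain ⟨φ, hφ⟩ := exists_induces A
  obtain ⟨h, hh⟩ := (mem_veechGroup_iff hφ).1 hX
  refine (mem_veechGroup_iff hφ).2 ?_
  have hw := map_monodromy hh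
  have hπw : ∀ w i, π (O'.monodromy w i) = O.monodromy w (π i) :=
    map_monodromy (φ := 1) (by simpa using hside)
  have hσw : ∀ w i, σ (O'.monodromy w i) = O'.monodromy w (σ i) :=
    map_monodromy (φ := 1) (by simpa using hσ)
  -- The conjugate commutes with the monodromy of every word `φ w`, hence with all words since `φ`
  -- is onto. It is therefore a translation.
  obtain ⟨a, ha⟩ : ∃ a : ℤ, h * σ * h⁻¹ = σ ^ a := by
    refine hcent _ fun k i => ?_
    have key : ∀ w i, h (σ (h⁻¹ (O'.monodromy (φ w) i))) =
        O'.monodromy (φ w) (h (σ (h⁻¹ i))) := by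
      intro w i
      have h1 : h⁻¹ (O'.monodromy (φ w) i) = O'.monodromy w (h⁻¹ i) := by
        rw [Equiv.Perm.inv_eq_iff_eq, hw, Equiv.Perm.coe_inv, Equiv.apply_symm_apply]
      rw [h1, hσw, hw]
    have := key (φ⁻¹ (FreeGroup.of k)) i
    simpa using this
  -- Fibres are orbits of the powers of `σ ^ n`, and `h` conjugates `σ ^ n` to `σ ^ (n * a)`.
  have hdesc : ∀ i j, π i = π j → π (h i) = π (h j) := by
    intro i j hij
    obtain ⟨t, rfl⟩ := (hfib i j).1 hij
    refine (hfib _ _).2 ⟨a * t, ?_⟩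
    have h1 : h * σ ^ (n * t) * h⁻¹ = σ ^ (n * (a * t)) := by
      rw [← conj_zpow, ha, ← zpow_mul]
      congr 1
      ring
    rw [← h1]
    simp
  have hfin := O.finite
  let g : O.Square → O.Square := fun i => π (h (Function.surjInv hπ i))
  have hg : ∀ i, g (π i) = π (h i) := fun i => hdesc _ _ (Function.surjInv_eq hπ _)
  have hgs : Function.Surjective g := by
    intro i
    obtain ⟨j, rfl⟩ := hπ i
    exact ⟨π (h⁻¹ j), by rw [hg, Equiv.Perm.coe_inv, Equiv.apply_symm_apply]⟩
  refine ⟨Equiv.ofBijective g (Finite.injective_iff_bijective.1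
    (Finite.injective_iff_surjective.2 hgs)), fun k i => ?_⟩
  obtain ⟨j, rfl⟩ := hπ i
  change g (O.side k (π j)) = O.monodromy _ (g (π j))
  rw [← hside, hg, hg, hh, hπw]

/-- Two permutations that commute with the monodromy and agree at a point are equal. -/
theorem eq_of_commute {g g' : Equiv.Perm O.Square} (hg : ∀ k i, g (O.side k i) = O.side k (g i))
    (hg' : ∀ k i, g' (O.side k i) = O.side k (g' i)) {i : O.Square} (h : g i = g' i) : g = g' := by
  ext j
  obtain ⟨w, rfl⟩ := exists_monodromy i j
  have h1 := map_monodromy (φ := 1) (h := g) (O' := O) (by simpa using hg) w i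
  have h2 := map_monodromy (φ := 1) (h := g') (O' := O) (by simpa using hg') w i
  rw [h1, h2, h]

/-! ### Finite index and the non-congruence criterion. -/

/-- A twist is determined by a pair of permutations of a finite set, and matrices yielding the same
pair lie in the same coset. -/
theorem finiteIndex_comap_veechGroup (O : Origami) :
    (O.veechGroup.comap (Matrix.SpecialLinearGroup.mapGL ℝ : SL(2, ℤ) →* _)).FiniteIndex := by
  have := O.finite
  choose φ hφ using exists_induces
  set G := O.veechGroup.comap (Matrix.SpecialLinearGroup.mapGL ℝ : SL(2, ℤ) →* _)
  have key : ∀ A B, (fun k => O.monodromy (φ A (FreeGroup.of k))) =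
      (fun k => O.monodromy (φ B (FreeGroup.of k))) → A⁻¹ * B ∈ G := by
    intro A B h
    have h1 : Iso (O.twist (φ B)) (O.twist (φ A)) :=
      ⟨Equiv.refl _, fun k i => by
        rw [side_twist, side_twist, ← congrFun h k]; rfl⟩
    have h2 := ((hφ B O).trans h1.lifts).trans (hφ A O).symm
    rw [one_mul] at h2
    exact h2.mem_veechGroup
  have : Finite (SL(2, ℤ) ⧸ G) := by
    refine Finite.of_injective (β := Fin 2 → Equiv.Perm O.Square)
      (fun q k => O.monodromy (φ q.out (FreeGroup.of k))) fun q q' h => ?_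
    rw [← q.out_eq', ← q'.out_eq']
    exact QuotientGroup.eq.2 (key _ _ h)
  exact Subgroup.finiteIndex_of_finite_quotient

/-- Write N = 3^b M with 3 ∤ M and solve e ≡ 1 mod 3^(b+1), e ≡ 0 mod 4M. The extra factors 3 and 4
give e ≡ 4 mod 12 even when they do not divide N. -/
theorem exists_idempotent_mod (N : ℕ) (hN : N ≠ 0) :
    ∃ e : ℤ, 12 ∣ e - 4 ∧ (N : ℤ) ∣ e * (1 - e) := by
  obtain ⟨b, M, hM, rfl⟩ := Nat.exists_eq_pow_mul_and_not_dvd hN 3 (by norm_num)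
  have hcop : IsCoprime ((3 : ℤ) ^ (b + 1)) (4 * M) := by
    refine IsCoprime.pow_left (IsCoprime.mul_right (by norm_num) ?_)
    exact_mod_cast Nat.isCoprime_iff_coprime.2
      ((Nat.Prime.coprime_iff_not_dvd Nat.prime_three).2 hM)
  obtain ⟨x, y, hxy⟩ := hcop
  refine ⟨y * (4 * M), ?_, ?_⟩
  · have h1 : (4 : ℤ) ∣ y * (4 * M) := ⟨y * M, by ring⟩
    have h2 : (3 : ℤ) ∣ 1 - y * (4 * M) := ⟨x * 3 ^ b, by rw [← hxy]; ring⟩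
    omega
  · refine ⟨y * 4 * (x * 3), ?_⟩
    have : 1 - y * (4 * M) = x * 3 ^ (b + 1) := by rw [← hxy]; ring
    rw [this]
    push_cast
    ring

/-- Upper and lower unipotents with entries `e` and `-f` commute modulo `e * f`, as the explicit
commutator shows. -/
theorem commutator_mem_Gamma {N : ℕ} {e f : ℤ} (h : (N : ℤ) ∣ e * f) :
    ModularGroup.T ^ e * ((ModularGroup.S * ModularGroup.T ^ f * ModularGroup.S⁻¹) *
      ModularGroup.T ^ (-e) * (ModularGroup.S * ModularGroup.T ^ f * ModularGroup.S⁻¹)⁻¹) ∈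
      CongruenceSubgroup.Gamma N := by
  have hef : (e : ZMod N) * f = 0 := by
    have := (ZMod.intCast_zmod_eq_zero_iff_dvd (e * f) N).2 h
    exact_mod_cast this
  have hinv : (ModularGroup.S * ModularGroup.T ^ f * ModularGroup.S⁻¹)⁻¹ =
      ModularGroup.S * ModularGroup.T ^ (-f) * ModularGroup.S⁻¹ := by
    group
  have hY : ∀ f : ℤ, (ModularGroup.S * ModularGroup.T ^ f * ModularGroup.S⁻¹).1 =
      !![1, 0; -f, 1] := by
    intro f
    simp [ModularGroup.coe_T_zpow, ModularGroup.coe_S, Matrix.SpecialLinearGroup.coe_inv,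
      Matrix.adjugate_fin_two]
  have hC : (ModularGroup.T ^ e * ((ModularGroup.S * ModularGroup.T ^ f * ModularGroup.S⁻¹) *
      ModularGroup.T ^ (-e) * (ModularGroup.S * ModularGroup.T ^ f * ModularGroup.S⁻¹)⁻¹)).1 =
      !![1 - e * f + (e * f) ^ 2, e * (e * f); f * (e * f), 1 + e * f] := by
    rw [hinv, Matrix.SpecialLinearGroup.coe_mul, Matrix.SpecialLinearGroup.coe_mul,
      Matrix.SpecialLinearGroup.coe_mul, hY, hY, ModularGroup.coe_T_zpow, ModularGroup.coe_T_zpow]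
    ext k l
    fin_cases k <;> fin_cases l <;> simp [Matrix.mul_apply, Fin.sum_univ_two] <;> ring
  rw [CongruenceSubgroup.Gamma_mem, hC]
  simp [hef]

/-- A criterion for Veech groups to be non-congruence groups. -/
theorem isNoncongruenceGroup_veechGroup
    (hT : ∀ s : ℤ, Matrix.SpecialLinearGroup.mapGL ℝ (ModularGroup.T ^ s) ∈ O.veechGroup → 3 ∣ s)
    (hp : ∀ e : ℤ, 12 ∣ e - 4 → (O.up ^ (-(1 - e)) * O.right) ^ e = 1) :
    IsNoncongruenceGroup O.veechGroup := by
  refine ⟨O.veechGroup.comap (Matrix.SpecialLinearGroup.mapGL ℝ), ?_,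
    finiteIndex_comap_veechGroup O, ?_⟩
  · rw [Subgroup.map_comap_eq, eq_comm, inf_eq_right]
    intro X hX
    obtain ⟨A, rfl, -⟩ := exists_lifts_of_mem hX
    exact ⟨A, rfl⟩
  · rintro ⟨N, hN, hle⟩
    obtain ⟨e, he, hNe⟩ := exists_idempotent_mod N hN
    have hmem := hle (commutator_mem_Gamma hNe)
    set Y := ModularGroup.S * ModularGroup.T ^ (1 - e) * ModularGroup.S⁻¹
    -- Along `Y⁻¹` the origami becomes `P`, whose horizontal permutation has trivial `e`-th power by
    -- `hp`. So T^(-e) lifts to `P`, and is conjugated back.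
    have hY : Lifts (Y * ModularGroup.T ^ (-e) * Y⁻¹) O O := by
      have hind : Induces Y⁻¹ (quarterTurn⁻¹ * shear (-(1 - e)) * quarterTurn) := by
        have := (induces_quarterTurn.inv.mul (induces_shear (-(1 - e)))).mul induces_quarterTurn
        have hYi : Y⁻¹ = ModularGroup.S * (ModularGroup.T ^ (-(1 - e)) * ModularGroup.S⁻¹) := by
          simp only [Y]; group
        rwa [hYi]
      set P := O.twist (quarterTurn⁻¹ * shear (-(1 - e)) * quarterTurn)
      have hright : P.right = O.up ^ (-(1 - e)) * O.right := by
        have h0 : quarterTurn⁻¹ (FreeGroup.of 0) = FreeGroup.of 1 := by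
          rw [MulAut.inv_apply, MulEquiv.symm_apply_eq]; simp [quarterTurn]
        have h1 : quarterTurn⁻¹ (FreeGroup.of 1) = (FreeGroup.of 0)⁻¹ := by
          rw [MulAut.inv_apply, MulEquiv.symm_apply_eq]; simp [quarterTurn]
        have h2 : quarterTurn (FreeGroup.of 0) = (FreeGroup.of 1)⁻¹ := by simp [quarterTurn]
        change O.monodromy (quarterTurn⁻¹ (shear _ (quarterTurn (FreeGroup.of 0)))) = _
        rw [h2, map_inv, shear_of_one, map_inv, map_mul, map_zpow, h0, h1]
        rw [map_inv, map_mul, map_inv, map_zpow, monodromy_of, monodromy_of,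
          mul_inv_rev, inv_inv, neg_neg, ← zpow_neg]
        rfl
      have hPT : Lifts (ModularGroup.T ^ (-e)) P P := by
        rw [← mapGL_mem_veechGroup, T_zpow_mem_veechGroup_iff]
        refine ⟨1, fun _ => rfl, fun i => ?_⟩
        rw [neg_neg, hright, hp e he]
        rfl
      have := ((hind O).trans hPT).trans (hind O).symm
      rwa [inv_inv, ← mul_assoc] at this
    -- Cancelling this factor from the commutator leaves T^e, so 3 ∣ e, while e ≡ 1 mod 3.
    have h3 := hT e (by
      have := (Subgroup.mul_mem_cancel_right _ hY.mem_veechGroup).1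
        (by rw [← map_mul]; exact hmem)
      exact this)
    omega

end Origami

/-! ### Cyclic copies: powers of the shift and fibres of the reduction of the copy index. -/

namespace Origami

theorem zpow_apply_of_translate {n c : ℕ} {ρ : Equiv.Perm (ZMod n × Fin c)} {d : Fin c → ZMod n}
    (h : ∀ k j, ρ (k, j) = (k + d j, j)) (z : ℤ) (k : ZMod n) (j : Fin c) :
    (ρ ^ z) (k, j) = (k + z * d j, j) := by
  induction z using Int.induction_on generalizing k with
  | zero => simp
  | succ z ih =>
    rw [zpow_add, zpow_one, Equiv.Perm.mul_apply, h, ih]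
    push_cast
    congr 1
    ring
  | pred z ih =>
    have hinv : ρ⁻¹ (k, j) = (k - d j, j) := by
      rw [Equiv.Perm.inv_eq_iff_eq, h, sub_add_cancel]
    rw [zpow_sub, zpow_one, Equiv.Perm.mul_apply, hinv, ih]
    push_cast
    congr 1
    ring

/-- The translation of `n` cyclically glued copies to the next copy. -/
def shift (n c : ℕ) : Equiv.Perm (ZMod n × Fin c) :=
  Equiv.prodCongr (Equiv.addRight 1) (Equiv.refl _)

theorem shift_zpow (n c : ℕ) (z : ℤ) (k : ZMod n) (j : Fin c) :
    (shift n c ^ z) (k, j) = (k + z, j) := by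
  rw [zpow_apply_of_translate (d := fun _ => 1) (fun _ _ => rfl), mul_one]

theorem castHom_eq_iff_shift {n m c : ℕ} (h : n ∣ m) (x y : ZMod m × Fin c) :
    Prod.map (ZMod.castHom h (ZMod n)) id x = Prod.map (ZMod.castHom h (ZMod n)) id y ↔
      ∃ t : ℤ, y = (shift m c ^ ((n : ℤ) * t)) x := by
  obtain ⟨a, i⟩ := x
  obtain ⟨b, j⟩ := y
  simp only [shift_zpow, Prod.map_apply, Prod.mk.injEq, id_eq]
  constructor
  · rintro ⟨hab, rfl⟩
    obtain ⟨d, hd⟩ := ZMod.intCast_surjective (b - a)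
    have : ((d : ℤ) : ZMod n) = 0 := by
      rw [← map_intCast (ZMod.castHom h (ZMod n)), hd, map_sub, hab, sub_self]
    obtain ⟨t, rfl⟩ := (ZMod.intCast_zmod_eq_zero_iff_dvd d n).1 this
    exact ⟨t, by rw [hd]; ring, rfl⟩
  · rintro ⟨t, rfl, rfl⟩
    refine ⟨?_, rfl⟩
    rw [map_add, map_intCast]
    simp

theorem zpow_apply_comm {S : Type*} {σ g : Equiv.Perm S} (h : ∀ i, σ (g i) = g (σ i)) (z : ℤ)
    (i : S) : (σ ^ z) (g i) = g ((σ ^ z) i) := by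
  have : Commute σ g := Equiv.ext h
  exact DFunLike.congr_fun (this.zpow_left z) i

/-! ### Copies of `L(2,3)` -/

theorem eq_one_of_rightL_eq {n : ℕ+} {k : ZMod n} {j : Fin 4} (h : rightL n (k, j) = (k, j)) :
    j = 1 := by
  fin_cases j
  · exact absurd (congrArg Prod.snd h) (by decide : (2 : Fin 4) ≠ 0)
  · rfl
  · exact absurd (congrArg Prod.snd h) (by decide : (3 : Fin 4) ≠ 2)
  · exact absurd (congrArg Prod.snd h) (by decide : (0 : Fin 4) ≠ 3)

/-- A permutation commuting with `rightL n` permutes its fixed squares, and these all have type 1.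
This applies both to translations and to the symmetries witnessing T^s. -/
theorem exists_map_seqL {n : ℕ+} {g : Equiv.Perm (seqL n).Square}
    (hg : ∀ i, g (rightL n i) = rightL n (g i)) : ∃ a : ZMod n, g (0, 1) = (a, 1) := by
  obtain ⟨⟨a, j⟩, ha⟩ : ∃ x : ZMod n × Fin 4, g (0, 1) = x := ⟨_, rfl⟩
  have h : rightL n (a, j) = (a, j) := by
    rw [← ha]
    exact (hg (0, 1)).symm
  exact ⟨a, by rw [ha, eq_one_of_rightL_eq h]⟩

theorem veechGroup_seqL_le {n m : ℕ+} (h : n ∣ m) :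
    (seqL m).veechGroup ≤ (seqL n).veechGroup := by
  have hd : (n : ℕ) ∣ m := PNat.dvd_iff.1 h
  have hσ : ∀ k i, shift m 4 ((seqL m).side k i) = (seqL m).side k (shift m 4 i) := by
    refine Fin.forall_fin_two.2 ⟨?_, ?_⟩ <;> rintro ⟨k, j⟩ <;> fin_cases j <;> rfl
  refine veechGroup_le_of_cover (O' := seqL m) (O := seqL n)
    (Prod.map (ZMod.castHom hd (ZMod n)) id)
    (Function.Surjective.prodMap (ZMod.castHom_surjective hd) Function.surjective_id)
    ?_ (shift m 4) hσ ?_ n (castHom_eq_iff_shift hd)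
  · refine Fin.forall_fin_two.2 ⟨?_, ?_⟩ <;> rintro ⟨k, j⟩ <;> fin_cases j <;>
      first
      | rfl
      | exact Prod.ext ((map_add _ _ _).trans (congrArg _ (map_one _))) rfl
  · intro g hg
    obtain ⟨a, ha⟩ := exists_map_seqL (hg 0)
    obtain ⟨z, rfl⟩ := ZMod.intCast_surjective a
    refine ⟨z, eq_of_commute hg (fun k => zpow_apply_comm (hσ k) z) (i := (0, 1)) ?_⟩
    rw [ha]
    exact ((shift_zpow _ _ _ _ _).trans (by rw [zero_add])).symm

theorem rightL_zpow_three_mul (n : ℕ+) (z : ℤ) (k : ZMod n) (j : Fin 4) :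
    (rightL n ^ (3 * z)) (k, j) = (k + z * (if j = 1 then 0 else 1), j) := by
  rw [zpow_mul]
  refine zpow_apply_of_translate (d := fun j => if j = 1 then 0 else 1) (fun k j => ?_) z k j
  fin_cases j
  · rfl
  · exact Prod.ext (add_zero k).symm rfl
  · rfl
  · rfl

theorem three_mul_dvd_of_rightL {n : ℕ+} {z : ℤ} {k : ZMod n}
    (h : (rightL n ^ z) (k, 0) = (k, 0)) : 3 * (n : ℤ) ∣ z := by
  obtain ⟨q, hq⟩ : ∃ q, z = 3 * q ∨ z = 1 + 3 * q ∨ z = 2 + 3 * q := ⟨z / 3, by omega⟩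
  rcases hq with rfl | rfl | rfl
  · rw [rightL_zpow_three_mul, if_neg (by decide)] at h
    have h1 := congrArg Prod.fst h
    simp only [mul_one, add_eq_left] at h1
    exact mul_dvd_mul_left _ ((ZMod.intCast_zmod_eq_zero_iff_dvd q n).1 h1)
  · rw [zpow_add, Equiv.Perm.mul_apply, rightL_zpow_three_mul] at h
    exact absurd (congrArg Prod.snd h) (by decide : (2 : Fin 4) ≠ 0)
  · rw [zpow_add, Equiv.Perm.mul_apply, rightL_zpow_three_mul] at h
    exact absurd (congrArg Prod.snd h) (by decide : (3 : Fin 4) ≠ 0)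

theorem T_zpow_mem_seqL_iff (n : ℕ+) (s : ℤ) :
    Matrix.SpecialLinearGroup.mapGL ℝ (ModularGroup.T ^ s) ∈ (seqL n).veechGroup ↔
      3 * (n : ℤ) ∣ s := by
  rw [T_zpow_mem_veechGroup_iff]
  constructor
  · rintro ⟨h, hr, hu⟩
    obtain ⟨a, ha⟩ := exists_map_seqL hr
    -- The shear has no effect at a horizontally fixed square, so the square below it is matched
    -- too. Going up again forces `rightL n ^ (-s)` to fix `(a, 0)`, which lies on the cycle of
    -- length 3n.
    have hfix : rightL n (a, 1) = (a, 1) := rfl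
    have hfix' : (rightL n ^ (-s)) (a, 1) = (a, 1) := by
      exact Equiv.Perm.zpow_apply_eq_self_of_apply_eq_self hfix _
    have h1 : h (0, 0) = (a, 0) := by
      have := hu (0, 1)
      rw [ha] at this
      exact this.trans (congrArg (upL n) hfix')
    have h2 := hu (0, 0)
    rw [h1] at h2
    have h3 : upL n (a, 0) = upL n ((rightL n ^ (-s)) (a, 0)) := ha.symm.trans h2
    have := three_mul_dvd_of_rightL ((upL n).injective h3).symm
    rwa [dvd_neg] at this
  · rintro ⟨t, rfl⟩
    refine ⟨1, fun _ => rfl, fun i => congrArg (upL n) ?_⟩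
    obtain ⟨k, j⟩ := i
    have := rightL_zpow_three_mul n (n * -t) k j
    have e : 3 * ((n : ℤ) * -t) = -(3 * n * t) := by ring
    rw [e] at this
    exact (this.trans (by simp)).symm

theorem isNoncongruenceGroup_seqL : IsNoncongruenceGroup (seqL 1).veechGroup := by
  refine isNoncongruenceGroup_veechGroup (fun s hs => ?_) fun e he => ?_
  · simpa using (T_zpow_mem_seqL_iff 1 s).1 hs
  -- Since e ≡ 4 mod 12, the exponent e - 1 is odd and 4 ∣ e; only the fourth power of `upL 1 *
  -- rightL 1` matters.
  · have hu : upL 1 ^ (2 : ℤ) = 1 := by decide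
    have hp : (upL 1 * rightL 1) ^ (4 : ℤ) = 1 := by decide
    obtain ⟨t, ht⟩ := he
    have h1 : -(1 - e) = 1 + 2 * (1 + 6 * t) := by linarith
    have h2 : e = 4 * (1 + 3 * t) := by linarith
    change (upL 1 ^ (-(1 - e)) * rightL 1) ^ e = 1
    rw [h1, zpow_add, zpow_mul, hu, one_zpow, zpow_one, mul_one, h2, zpow_mul, hp, one_zpow]

/-! ### Copies of `D` -/

theorem eq_three_or_four_of_rightD_eq {n : ℕ+} {k : ZMod n} {j : Fin 5}
    (h : rightD n (k, j) = (k, j)) : j = 3 ∨ j = 4 := by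
  fin_cases j
  · exact absurd (congrArg Prod.snd h) (by decide : (1 : Fin 5) ≠ 0)
  · exact absurd (congrArg Prod.snd h) (by decide : (2 : Fin 5) ≠ 1)
  · exact absurd (congrArg Prod.snd h) (by decide : (0 : Fin 5) ≠ 2)
  · exact Or.inl rfl
  · exact Or.inr rfl

/-- Types 3 and 4 are both fixed horizontally, but going up from 3 reaches the fixed type 4, while
going up from 4 reaches the moved type 0. The case s = 0 handles translations, other `s` the shears.
-/
theorem exists_map_seqD {n : ℕ+} {s : ℤ} {g : Equiv.Perm (seqD n).Square}
    (hr : ∀ i, g (rightD n i) = rightD n (g i))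
    (hu : ∀ i, g (upD n i) = upD n ((rightD n ^ s) (g i))) : ∃ a : ZMod n, g (0, 3) = (a, 3) := by
  obtain ⟨⟨a, j⟩, ha⟩ : ∃ x : ZMod n × Fin 5, g (0, 3) = x := ⟨_, rfl⟩
  have h : rightD n (a, j) = (a, j) := by
    rw [← ha]
    exact (hr (0, 3)).symm
  rcases eq_three_or_four_of_rightD_eq h with rfl | rfl
  · exact ⟨a, ha⟩
  · have h1 : g (0, 4) = (a, 0) := by
      refine (hu (0, 3)).trans ?_
      rw [ha, Equiv.Perm.zpow_apply_eq_self_of_apply_eq_self h]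
      rfl
    have h2 : rightD n (a, 0) = (a, 0) := by
      rw [← h1]
      exact (hr (0, 4)).symm
    exact absurd (eq_three_or_four_of_rightD_eq h2) (by decide)

theorem veechGroup_seqD_le {n m : ℕ+} (h : n ∣ m) :
    (seqD m).veechGroup ≤ (seqD n).veechGroup := by
  have hd : (n : ℕ) ∣ m := PNat.dvd_iff.1 h
  have hσ : ∀ k i, shift m 5 ((seqD m).side k i) = (seqD m).side k (shift m 5 i) := by
    refine Fin.forall_fin_two.2 ⟨?_, ?_⟩ <;> rintro ⟨k, j⟩ <;> fin_cases j <;> rfl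
  refine veechGroup_le_of_cover (O' := seqD m) (O := seqD n)
    (Prod.map (ZMod.castHom hd (ZMod n)) id)
    (Function.Surjective.prodMap (ZMod.castHom_surjective hd) Function.surjective_id)
    ?_ (shift m 5) hσ ?_ n (castHom_eq_iff_shift hd)
  · refine Fin.forall_fin_two.2 ⟨?_, ?_⟩ <;> rintro ⟨k, j⟩ <;> fin_cases j <;>
      first
      | rfl
      | exact Prod.ext ((map_add _ _ _).trans (congrArg _ (map_one _))) rfl
  · intro g hg
    obtain ⟨a, ha⟩ := exists_map_seqD (s := 0) (hg 0) (hg 1)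
    obtain ⟨z, rfl⟩ := ZMod.intCast_surjective a
    refine ⟨z, eq_of_commute hg (fun k => zpow_apply_comm (hσ k) z) (i := (0, 3)) ?_⟩
    rw [ha]
    exact ((shift_zpow _ _ _ _ _).trans (by rw [zero_add])).symm

theorem rightD_zpow_three_mul (n : ℕ+) (z : ℤ) (k : ZMod n) (j : Fin 5) :
    (rightD n ^ (3 * z)) (k, j) = (k + z * (if 3 ≤ j then 0 else 1), j) := by
  rw [zpow_mul]
  refine zpow_apply_of_translate (d := fun j => if 3 ≤ j then 0 else 1) (fun k j => ?_) z k j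
  fin_cases j
  · rfl
  · rfl
  · rfl
  · exact Prod.ext (add_zero k).symm rfl
  · exact Prod.ext (add_zero k).symm rfl

theorem three_mul_dvd_of_rightD {n : ℕ+} {z : ℤ} {k : ZMod n}
    (h : (rightD n ^ z) (k, 0) = (k, 0)) : 3 * (n : ℤ) ∣ z := by
  obtain ⟨q, hq⟩ : ∃ q, z = 3 * q ∨ z = 1 + 3 * q ∨ z = 2 + 3 * q := ⟨z / 3, by omega⟩
  rcases hq with rfl | rfl | rfl
  · rw [rightD_zpow_three_mul, if_neg (by decide)] at h
    have h1 := congrArg Prod.fst h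
    simp only [mul_one, add_eq_left] at h1
    exact mul_dvd_mul_left _ ((ZMod.intCast_zmod_eq_zero_iff_dvd q n).1 h1)
  · rw [zpow_add, Equiv.Perm.mul_apply, rightD_zpow_three_mul] at h
    exact absurd (congrArg Prod.snd h) (by decide : (1 : Fin 5) ≠ 0)
  · rw [zpow_add, Equiv.Perm.mul_apply, rightD_zpow_three_mul] at h
    exact absurd (congrArg Prod.snd h) (by decide : (2 : Fin 5) ≠ 0)

theorem T_zpow_mem_seqD_iff (n : ℕ+) (s : ℤ) :
    Matrix.SpecialLinearGroup.mapGL ℝ (ModularGroup.T ^ s) ∈ (seqD n).veechGroup ↔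
      3 * (n : ℤ) ∣ s := by
  rw [T_zpow_mem_veechGroup_iff]
  constructor
  · rintro ⟨h, hr, hu⟩
    obtain ⟨a, ha⟩ := exists_map_seqD hr hu
    have h1 : h (0, 4) = (a, 4) := by
      refine (hu (0, 3)).trans ?_
      rw [ha]
      exact congrArg (upD n) (Equiv.Perm.zpow_apply_eq_self_of_apply_eq_self
        (rfl : rightD n (a, 3) = (a, 3)) _)
    have h2 : h (0, 0) = (a, 0) := by
      refine (hu (0, 4)).trans ?_
      rw [h1]
      exact congrArg (upD n) (Equiv.Perm.zpow_apply_eq_self_of_apply_eq_self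
        (rfl : rightD n (a, 4) = (a, 4)) _)
    have h3 := hu (0, 0)
    rw [h2] at h3
    have h4 : upD n (a, 0) = upD n ((rightD n ^ (-s)) (a, 0)) := ha.symm.trans h3
    have := three_mul_dvd_of_rightD ((upD n).injective h4).symm
    rwa [dvd_neg] at this
  · rintro ⟨t, rfl⟩
    refine ⟨1, fun _ => rfl, fun i => congrArg (upD n) ?_⟩
    obtain ⟨k, j⟩ := i
    have := rightD_zpow_three_mul n (n * -t) k j
    have e : 3 * ((n : ℤ) * -t) = -(3 * n * t) := by ring
    rw [e] at this
    exact (this.trans (by simp)).symm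

theorem isNoncongruenceGroup_seqD : IsNoncongruenceGroup (seqD 1).veechGroup := by
  refine isNoncongruenceGroup_veechGroup (fun s hs => ?_) fun e he => ?_
  · simpa using (T_zpow_mem_seqD_iff 1 s).1 hs
  -- Here e - 1 ≡ 3 mod 6 and e is even, so the word reduces to `upD 1 ^ 3 * rightD 1`, whose square
  -- is trivial.
  · have hu : upD 1 ^ (6 : ℤ) = 1 := by decide
    have hp : (upD 1 ^ (3 : ℤ) * rightD 1) ^ (2 : ℤ) = 1 := by decide
    obtain ⟨t, ht⟩ := he
    have h1 : -(1 - e) = 3 + 6 * (2 * t) := by linarith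
    have h2 : e = 2 * (2 + 6 * t) := by linarith
    change (upD 1 ^ (-(1 - e)) * rightD 1) ^ e = 1
    rw [h1, zpow_add, zpow_mul, hu, one_zpow, mul_one, h2, zpow_mul, hp, one_zpow]

end Origami

/-! ### The main theorem. -/

theorem mainTheorem3 (O : ℕ+ → Origami) (hO : O = Origami.seqL ∨ O = Origami.seqD) :
    (∀ n, (O n).veechGroup ≤ (O 1).veechGroup) ∧
    IsNoncongruenceGroup (O 1).veechGroup ∧
    (∀ n m : ℕ+, n ∣ m → (O m).veechGroup ≤ (O n).veechGroup) ∧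
    (∀ n m : ℕ+, n ≠ m → (O n).veechGroup ≠ (O m).veechGroup) ∧
    (∀ (n : ℕ+) (s : ℤ),
      Matrix.SpecialLinearGroup.mapGL ℝ (ModularGroup.T ^ s) ∈ (O n).veechGroup ↔
        3 * (n : ℤ) ∣ s) := by
  have hle : ∀ n m : ℕ+, n ∣ m → (O m).veechGroup ≤ (O n).veechGroup := by
    rcases hO with rfl | rfl
    · exact fun _ _ => Origami.veechGroup_seqL_le
    · exact fun _ _ => Origami.veechGroup_seqD_le
  have hT : ∀ (n : ℕ+) (s : ℤ),
      Matrix.SpecialLinearGroup.mapGL ℝ (ModularGroup.T ^ s) ∈ (O n).veechGroup ↔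
        3 * (n : ℤ) ∣ s := by
    rcases hO with rfl | rfl
    · exact Origami.T_zpow_mem_seqL_iff
    · exact Origami.T_zpow_mem_seqD_iff
  -- The powers of T in the group recover n: test T^(3n).
  have hdvd : ∀ n m : ℕ+, (O n).veechGroup = (O m).veechGroup → m ∣ n := by
    intro n m h
    have h1 := (hT n (3 * n)).2 dvd_rfl
    rw [h, hT] at h1
    have h2 := Int.dvd_of_mul_dvd_mul_left (by norm_num) h1
    exact PNat.dvd_iff.2 (by exact_mod_cast h2)
  refine ⟨fun n => hle 1 n (one_dvd n), ?_, hle, fun n m hnm h => hnm ?_, hT⟩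
  · rcases hO with rfl | rfl
    · exact Origami.isNoncongruenceGroup_seqL
    · exact Origami.isNoncongruenceGroup_seqD
  · exact PNat.dvd_antisymm (hdvd m n h.symm) (hdvd n m h)
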